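/- Let $0<q<1$. For a set $S\subset\mathbb Z$ and a reference configuration $\Omega\in\{\uparrow,\downarrow\}^S$, the Guichardet Hilbert space (incomplete tensor product) over $\Omega$ has as orthonormal basis the product vectors $|\sigma\rangle$, where $\sigma\in\{\uparrow,\downarrow\}^S$ differs from $\Omega$ at finitely many sites. For a finite set $A\subset S$ let $|A\downarrow\rangle_S$ (resp. $|A\uparrow\rangle_S$) be the basis vector whose down-spins (resp. up-spins) are exactly at the sites of $A$. For integers $n\ge 0$ put $$\psi^{k}_{[1,\infty)}(n)=\sum_{\substack{A\subset[1,\infty)\\|A|=n}}q^{\sum_{x\in A}x}\,|A\downarrow\rangle,\quad \psi^{a}_{(-\infty,0]}(n)=\sum_{\substack{A\subset(-\infty,0]\\|A|=n}}q^{\sum_{x\in A}(1-x)}\,|A\downarrow\rangle,\quad \widetilde\psi^{k}_{(-\infty,0]}(n)=\sum_{\substack{A\subset(-\infty,0]\\|A|=n}}q^{\sum_{x\in A}(1-x)}\,|A\uparrow\rangle,$$ and let these vectors be $0$ for $n<0$. The infinite-volume antikink–kink (pinned droplet) state with $n$ down-spins is $$\psi^{ak}_\infty(n)=\sum_{k=0}^{n}q^{-k}\,\psi^{a}_{(-\infty,0]}(k)\otimes\psi^{k}_{[1,\infty)}(n-k),$$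 a vector in the Guichardet space over the all-up configuration of $\mathbb Z$. For $n\in\mathbb Z$ the bi-infinite kink state is $$\widehat\psi^{k}(n)=q^{-n(n+1)/2}\sum_{k=0}^{\infty}q^{-k}\,\widetilde\psi^{k}_{(-\infty,0]}(k)\otimes\psi^{k}_{[1,\infty)}(n+k),$$ a vector in the Guichardet space over the configuration that is $\downarrow$ on $x\le 0$ and $\uparrow$ on $x\geq 1$. For a finite set $\Lambda\subset\mathbb Z$ let $\mathcal A_\Lambda$ be the algebra of linear operators on $(\mathbb C^2)^{\otimes\Lambda}$, acting on these spaces over $\mathbb Z$ as $X\otimes 1$, and let $\mathrm{Ad}\,\tau^m:\mathcal A_\Lambda\to\mathcal A_{\Lambda+m}$ be translation by $m$. Write $(q^2;q^2)_\infty=\prod_{j\ge1}(1-q^{2j})$. **Proposition.** For every finite $\Lambda\subset\mathbb Z$ and every $X\in\mathcal A_\Lambda$, $$\lim_{\substack{n\to\infty\\ n\text{ even}}}\frac{\langle\psi^{ak}_\infty(n),\mathrm{Ad}\,\tau^{n/2}(X)\,\psi^{ak}_\infty(n)\rangle}{\langle\psi^{ak}_\infty(n),\psi^{ak}_\infty(n)\rangle}=\frac{\sum_{k\in\mathbb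 Z}q^{2k(k+1)}\langle\widehat\psi^{k}(k),X\widehat\psi^{k}(k)\rangle}{\sum_{k\in\mathbb Z}q^{2k(k+1)}\,(q^2;q^2)_\infty^{-1}}$$ and $$\lim_{\substack{n\to\infty\\ n\text{ odd}}}\frac{\langle\psi^{ak}_\infty(n),\mathrm{Ad}\,\tau^{(n-1)/2}(X)\,\psi^{ak}_\infty(n)\rangle}{\langle\psi^{ak}_\infty(n),\psi^{ak}_\infty(n)\rangle}=\frac{\sum_{k\in\mathbb Z}q^{2k^2}\langle\widehat\psi^{k}(k),X\widehat\psi^{k}(k)\rangle}{\sum_{k\in\mathbb Z}q^{2k^2}\,(q^2;q^2)_\infty^{-1}},$$ where all the series on the right-hand sides converge absolutely. -/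

import Mathlib

open Filter Topology

noncomputable section

namespace XXZ

/-! ### Spins, configurations and the Guichardet Hilbert spaces -/

/-- The two basis labels of the one-site space `ℂ²`. -/
inductive Spin
  | up
  | down
  deriving DecidableEq

instance : Fintype Spin := ⟨{Spin.up, Spin.down}, fun s => by cases s <;> simp⟩

/-- Configurations on the sites `S` which differ from the reference configuration `Ω` at only
finitely many sites. -/
def Cfg {S : Type} (Ω : S → Spin) : Type := {σ : S → Spin // {x | σ x ≠ Ω x}.Finite}

/-- The Guichardet Hilbert space (incomplete tensor product) of `⨂_{x ∈ S} (ℂ², |Ω x⟩)`: the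
product vectors `⨂_x |σ x⟩`, where `σ` differs from `Ω` at finitely many sites, are an orthonormal
basis, and a vector is the square-summable family of its coefficients in this basis. -/
abbrev Guichardet {S : Type} (Ω : S → Spin) : Type := lp (fun _ : Cfg Ω => ℂ) 2

/-- Square-summability is membership in `ℓ²`. -/
theorem memlp_two_iff {ι : Type} {f : ι → ℂ} :
    Memℓp f 2 ↔ Summable fun i => ‖f i‖ ^ 2 := by
  rw [memℓp_gen_iff (by norm_num)]
  simp

/-! ### States with finitely many flipped spins -/

/-- The finite set of sites at which `σ` differs from the reference configuration. -/
def Cfg.flipped {S : Type} {Ω : S → Spin} (σ : Cfg Ω) : Finset S := σ.2.toFinset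

theorem Cfg.flipped_injective {S : Type} (v : Spin) :
    Function.Injective (Cfg.flipped : Cfg (fun _ : S => v) → Finset S) := by
  intro σ τ h
  apply Subtype.ext
  funext x
  have hx : σ.1 x ≠ v ↔ τ.1 x ≠ v := by
    have := congrArg (fun s => x ∈ s) h
    simpa [Cfg.flipped] using this
  cases v <;> cases h1 : σ.1 x <;> cases h2 : τ.1 x <;> simp_all

theorem summable_weight {S : Type} {q : ℝ} (hq : q ∈ Set.Ioo (0 : ℝ) 1) (v : Spin) (h : S → ℤ)
    (hs : Summable fun x => (q ^ h x) ^ 2) :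
    Summable fun σ : Cfg (fun _ : S => v) => (q ^ (∑ x ∈ σ.flipped, h x)) ^ 2 := by
  have h1 : Summable fun s : Finset S => ∏ x ∈ s, (q ^ h x) ^ 2 :=
    summable_finsetProd_of_summable_nonneg (fun x => sq_nonneg _) hs
  refine (h1.comp_injective (Cfg.flipped_injective v)).congr fun σ => ?_
  have : ∀ s : Finset S, q ^ (∑ x ∈ s, h x) = ∏ x ∈ s, q ^ h x := by
    classical
    intro s
    induction s using Finset.induction_on with
    | empty => simp
    | insert a s ha ih => rw [Finset.sum_insert ha, Finset.prod_insert ha, zpow_add₀ hq.1.ne', ih]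
  simp [this, Finset.prod_pow]

/-- The vector `∑ q ^ (h x₁ + ⋯ + h xₙ) |flipped exactly at x₁, …, xₙ⟩`, the sum running over all
sets of `n` distinct sites of `S`, where the unflipped sites carry the spin `v`.
It is zero for `n < 0`. -/
def flipState {S : Type} {q : ℝ} (hq : q ∈ Set.Ioo (0 : ℝ) 1) (v : Spin) (h : S → ℤ)
    (hs : Summable fun x => (q ^ h x) ^ 2) (n : ℤ) : Guichardet (fun _ : S => v) :=
  ⟨fun σ => if (σ.flipped.card : ℤ) = n then ((q ^ (∑ x ∈ σ.flipped, h x) : ℝ) : ℂ) else 0, by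
    refine memlp_two_iff.2 (Summable.of_nonneg_of_le (fun σ => sq_nonneg _) (fun σ => ?_)
      (summable_weight hq v h hs))
    split_ifs
    · rw [Complex.norm_real, Real.norm_eq_abs, sq_abs]
    · rw [norm_zero, zero_pow two_ne_zero]
      exact sq_nonneg _⟩

theorem summable_right {q : ℝ} (hq : q ∈ Set.Ioo (0 : ℝ) 1) (a c : ℤ) :
    Summable fun x : Set.Ici a => (q ^ ((x : ℤ) - a + c)) ^ 2 := by
  have hg : Summable fun n : ℕ => (q ^ c) ^ 2 * (q ^ 2) ^ n :=
    (summable_geometric_of_lt_one (by positivity)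
      (pow_lt_one₀ hq.1.le hq.2 (by norm_num))).mul_left _
  have hi : Function.Injective fun x : Set.Ici a => ((x : ℤ) - a).toNat := by
    rintro ⟨x, hx⟩ ⟨y, hy⟩ hxy
    simp only [Set.mem_Ici] at hx hy
    simp only [Subtype.mk.injEq] at hxy ⊢
    omega
  refine (hg.comp_injective hi).congr ?_
  rintro ⟨x, hx⟩
  simp only [Set.mem_Ici] at hx
  have h1 : ((((x - a).toNat : ℕ) : ℤ)) = x - a := Int.toNat_of_nonneg (by omega)
  have h2 : q ^ (x - a).toNat = q ^ (x - a) := by rw [← zpow_natCast, h1]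
  simp only [Function.comp]
  rw [← pow_mul, mul_comm 2, pow_mul, h2, zpow_add₀ hq.1.ne']
  ring

theorem summable_left {q : ℝ} (hq : q ∈ Set.Ioo (0 : ℝ) 1) (b c : ℤ) :
    Summable fun x : Set.Iic b => (q ^ (b + c - (x : ℤ))) ^ 2 := by
  have hi : Function.Injective
      fun x : Set.Iic b => (⟨-(x : ℤ), neg_le_neg (Set.mem_Iic.1 x.2)⟩ : Set.Ici (-b)) := by
    rintro ⟨x, hx⟩ ⟨y, hy⟩ hxy
    have h := congrArg Subtype.val hxy
    exact Subtype.ext (neg_injective h)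
  refine ((summable_right hq (-b) c).comp_injective hi).congr ?_
  rintro ⟨x, hx⟩
  simp only [Function.comp]
  congr 2
  ring

/-- `ψᵏ_{[a,∞)}(n)`: the kink state on `[a,∞)` with `n` down-spins. -/
def kinkRight {q : ℝ} (hq : q ∈ Set.Ioo (0 : ℝ) 1) (a n : ℤ) :
    Guichardet (fun _ : Set.Ici a => Spin.up) :=
  flipState hq Spin.up (fun x => (x : ℤ) - a + 1) (summable_right hq a 1) n

/-- `ψᵃ_{(-∞,b]}(n)`: the antikink state on `(-∞,b]` with `n` down-spins. -/
def antikinkLeft {q : ℝ} (hq : q ∈ Set.Ioo (0 : ℝ) 1) (b n : ℤ) :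
    Guichardet (fun _ : Set.Iic b => Spin.up) :=
  flipState hq Spin.up (fun x => b + 1 - (x : ℤ)) (summable_left hq b 1) n

/-- `ψ̃ᵏ_{(-∞,b]}(n)`: the kink state on `(-∞,b]` with `n` up-spins. -/
def kinkLeft {q : ℝ} (hq : q ∈ Set.Ioo (0 : ℝ) 1) (b n : ℤ) :
    Guichardet (fun _ : Set.Iic b => Spin.down) :=
  flipState hq Spin.down (fun x => b + 1 - (x : ℤ)) (summable_left hq b 1) n

/-! ### Gluing the two half-lines -/

/-- The restriction of a configuration to a set of sites. -/
def Cfg.restrict {Ω : ℤ → Spin} (σ : Cfg Ω) (S : Set ℤ) (Ω' : S → Spin)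
    (h : ∀ x : S, Ω x = Ω' x) : Cfg Ω' :=
  ⟨fun x => σ.1 x, by
    refine Set.Finite.of_finite_image (f := Subtype.val) (σ.2.subset ?_)
      Subtype.val_injective.injOn
    rintro _ ⟨x, hx, rfl⟩
    simpa [h x] using hx⟩

theorem summable_glue {S T : Type} {Ω₁ : S → Spin} {Ω₂ : T → Spin}
    (φ : Guichardet Ω₁) (χ : Guichardet Ω₂) :
    Summable fun p : Cfg Ω₁ × Cfg Ω₂ => ‖φ.1 p.1 * χ.1 p.2‖ ^ 2 := by
  refine ((memlp_two_iff.1 φ.2).mul_of_nonneg (memlp_two_iff.1 χ.2)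
    (fun _ => by positivity) (fun _ => by positivity)).congr fun p => ?_
  rw [norm_mul, mul_pow]

theorem restrict_injective {Ω : ℤ → Spin} {Ω₁ : Set.Iic (0 : ℤ) → Spin}
    {Ω₂ : Set.Ici (1 : ℤ) → Spin}
    (h₁ : ∀ x : Set.Iic (0 : ℤ), Ω x = Ω₁ x) (h₂ : ∀ x : Set.Ici (1 : ℤ), Ω x = Ω₂ x) :
    Function.Injective fun σ : Cfg Ω => (σ.restrict _ Ω₁ h₁, σ.restrict _ Ω₂ h₂) := by
  intro σ τ h
  apply Subtype.ext
  funext x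
  have ha := congrArg (fun p => p.1.1) h
  have hb := congrArg (fun p => p.2.1) h
  rcases le_or_gt x 0 with hx | hx
  · exact congrFun ha ⟨x, hx⟩
  · exact congrFun hb ⟨x, hx⟩

/-- The tensor product `φ ⊗ χ` of a vector on `(-∞,0]` and a vector on `[1,∞)`, as a vector
on the whole lattice `ℤ`. -/
def tensor (Ω : ℤ → Spin) {Ω₁ : Set.Iic (0 : ℤ) → Spin} {Ω₂ : Set.Ici (1 : ℤ) → Spin}
    (h₁ : ∀ x : Set.Iic (0 : ℤ), Ω x = Ω₁ x) (h₂ : ∀ x : Set.Ici (1 : ℤ), Ω x = Ω₂ x)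
    (φ : Guichardet Ω₁) (χ : Guichardet Ω₂) : Guichardet Ω :=
  ⟨fun σ => φ.1 (σ.restrict _ Ω₁ h₁) * χ.1 (σ.restrict _ Ω₂ h₂), by
    have h := (summable_glue φ χ).comp_injective (restrict_injective h₁ h₂)
    exact memlp_two_iff.2 h⟩

/-- The all-up reference configuration on `ℤ`. -/
def allUp : ℤ → Spin := fun _ => Spin.up

/-- The kink reference configuration on `ℤ`. -/
def kinkRef : ℤ → Spin := fun x => if 0 < x then Spin.up else Spin.down

/-- The infinite-volume antikink–kink state with `n` down-spins,
`ψᵃᵏ_∞(n) = ∑_{k=0}^n q⁻ᵏ ψᵃ_{(-∞,0]}(k) ⊗ ψᵏ_{[1,∞)}(n-k)`. -/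
def antikinkKink {q : ℝ} (hq : q ∈ Set.Ioo (0 : ℝ) 1) (n : ℕ) : Guichardet allUp :=
  ∑ k ∈ Finset.range (n + 1), ((q ^ (-(k : ℤ)) : ℝ) : ℂ) •
    tensor allUp (fun _ => rfl) (fun _ => rfl)
      (antikinkLeft hq 0 k) (kinkRight hq 1 ((n : ℤ) - k))

theorem kinkRef_left (x : Set.Iic (0 : ℤ)) : kinkRef x = Spin.down := by
  have : (x : ℤ) ≤ 0 := x.2
  simp [kinkRef, this]

theorem kinkRef_right (x : Set.Ici (1 : ℤ)) : kinkRef x = Spin.up := by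
  have : (1 : ℤ) ≤ x := x.2
  have : (0 : ℤ) < x := by omega
  simp [kinkRef, this]

/-- The `k`-th term of the series that defines the bi-infinite kink state. -/
def kinkTerm {q : ℝ} (hq : q ∈ Set.Ioo (0 : ℝ) 1) (n : ℤ) (k : ℕ) : Guichardet kinkRef :=
  ((q ^ (-(k : ℤ)) : ℝ) : ℂ) •
    tensor kinkRef kinkRef_left kinkRef_right (kinkLeft hq 0 k) (kinkRight hq 1 (n + k))

theorem norm_sq_eq {S : Type} {Ω : S → Spin} (φ : Guichardet Ω) :
    ‖φ‖ ^ 2 = ∑' σ : Cfg Ω, ‖φ.1 σ‖ ^ 2 := by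
  have := lp.norm_rpow_eq_tsum (p := 2) (by norm_num) φ
  simpa using this

theorem norm_tensor_le (Ω : ℤ → Spin) {Ω₁ : Set.Iic (0 : ℤ) → Spin} {Ω₂ : Set.Ici (1 : ℤ) → Spin}
    (h₁ : ∀ x : Set.Iic (0 : ℤ), Ω x = Ω₁ x) (h₂ : ∀ x : Set.Ici (1 : ℤ), Ω x = Ω₂ x)
    (φ : Guichardet Ω₁) (χ : Guichardet Ω₂) : ‖tensor Ω h₁ h₂ φ χ‖ ≤ ‖φ‖ * ‖χ‖ := by
  refine (sq_le_sq₀ (norm_nonneg _) (by positivity)).1 ?_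
  have hs := summable_glue φ χ
  have e : ∀ p : Cfg Ω₁ × Cfg Ω₂, ‖φ.1 p.1 * χ.1 p.2‖ ^ 2 = ‖φ.1 p.1‖ ^ 2 * ‖χ.1 p.2‖ ^ 2 :=
    fun p => by rw [norm_mul, mul_pow]
  rw [mul_pow, norm_sq_eq, norm_sq_eq φ, norm_sq_eq χ,
    (memlp_two_iff.1 φ.2).tsum_mul_tsum (memlp_two_iff.1 χ.2) (hs.congr e)]
  have := tsum_comp_le_tsum_of_inj hs (fun p => sq_nonneg _) (restrict_injective h₁ h₂)
  simp only [e] at this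
  refine le_trans (le_of_eq ?_) this
  refine tsum_congr fun σ => ?_
  exact e (σ.restrict _ Ω₁ h₁, σ.restrict _ Ω₂ h₂)

theorem summable_norm_flipState {S : Type} {q : ℝ} (hq : q ∈ Set.Ioo (0 : ℝ) 1) (v : Spin)
    (h : S → ℤ) (hs : Summable fun x => (q ^ h x) ^ 2) :
    Summable fun n : ℤ => ‖flipState hq v h hs n‖ ^ 2 := by
  have h1 := ((summable_weight hq v h hs).hasSum.tsum_fiberwise
    (fun σ => (σ.flipped.card : ℤ))).summable
  refine h1.congr fun n => ?_
  rw [norm_sq_eq, tsum_subtype ((fun σ : Cfg (fun _ : S => v) => (σ.flipped.card : ℤ)) ⁻¹' {n})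
    (fun σ => (q ^ (∑ x ∈ σ.flipped, h x)) ^ 2)]
  refine tsum_congr fun σ => ?_
  change _ = ‖if (σ.flipped.card : ℤ) = n then
    ((q ^ (∑ x ∈ σ.flipped, h x) : ℝ) : ℂ) else 0‖ ^ 2
  by_cases hn : (σ.flipped.card : ℤ) = n
  · rw [if_pos hn, Set.indicator_of_mem (by simpa using hn), Complex.norm_real,
      Real.norm_eq_abs, sq_abs]
  · rw [if_neg hn, Set.indicator_of_notMem (by simpa using hn)]
    simp

theorem smul_kinkLeft {q : ℝ} (hq : q ∈ Set.Ioo (0 : ℝ) 1) (k : ℤ) :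
    ((q ^ (-k) : ℝ) : ℂ) • kinkLeft hq 0 k =
      flipState hq Spin.down (fun x : Set.Iic (0 : ℤ) => 0 + 0 - (x : ℤ)) (summable_left hq 0 0) k := by
  apply Subtype.ext
  funext σ
  change ((q ^ (-k) : ℝ) : ℂ) * (if (σ.flipped.card : ℤ) = k then
    ((q ^ (∑ x ∈ σ.flipped, (0 + 1 - (x : ℤ))) : ℝ) : ℂ) else 0) =
    if (σ.flipped.card : ℤ) = k then
    ((q ^ (∑ x ∈ σ.flipped, (0 + 0 - (x : ℤ))) : ℝ) : ℂ) else 0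
  split_ifs with hk
  · rw [← Complex.ofReal_mul, ← zpow_add₀ hq.1.ne']
    congr 3
    rw [← hk]
    simp [Finset.sum_sub_distrib]
    ring
  · simp

/-- The series that defines the bi-infinite kink state converges absolutely. -/
theorem summable_kinkTerm {q : ℝ} (hq : q ∈ Set.Ioo (0 : ℝ) 1) (n : ℤ) :
    Summable (kinkTerm hq n) := by
  have h1 := (summable_norm_flipState hq Spin.down _ (summable_left hq 0 0)).comp_injective
    (i := fun k : ℕ => (k : ℤ)) Nat.cast_injective
  have h2 := (summable_norm_flipState hq Spin.up _ (summable_right hq 1 1)).comp_injective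
    (i := fun k : ℕ => n + (k : ℤ)) (fun a b hab => by simpa using hab)
  refine Summable.of_norm_bounded (h1.add h2) fun k => ?_
  have h3 := norm_tensor_le kinkRef kinkRef_left kinkRef_right
    (kinkLeft hq 0 k) (kinkRight hq 1 (n + k))
  have h4 := congrArg norm (smul_kinkLeft hq k)
  rw [norm_smul] at h4
  rw [kinkTerm, norm_smul]
  refine (mul_le_mul_of_nonneg_left h3 (norm_nonneg _)).trans ?_
  rw [← mul_assoc, h4]
  simp only [Function.comp, kinkRight]
  nlinarith [sq_nonneg (‖flipState hq Spin.down (fun x : Set.Iic (0 : ℤ) => 0 + 0 - (x : ℤ))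
      (summable_left hq 0 0) k‖ - ‖flipState hq Spin.up (fun x : Set.Ici (1 : ℤ) => (x : ℤ) - 1 + 1)
      (summable_right hq 1 1) (n + k)‖),
    sq_nonneg (‖flipState hq Spin.down (fun x : Set.Iic (0 : ℤ) => 0 + 0 - (x : ℤ))
      (summable_left hq 0 0) k‖),
    sq_nonneg (‖flipState hq Spin.up (fun x : Set.Ici (1 : ℤ) => (x : ℤ) - 1 + 1)
      (summable_right hq 1 1) (n + k)‖)]

/-- The bi-infinite kink state
`ψ̂ᵏ(n) = q^{-n(n+1)/2} ∑_{k=0}^∞ q⁻ᵏ ψ̃ᵏ_{(-∞,0]}(k) ⊗ ψᵏ_{[1,∞)}(n+k)`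
(the series converges, see `summable_kinkTerm`; the integer `n(n+1)` is even). -/
def kink {q : ℝ} (hq : q ∈ Set.Ioo (0 : ℝ) 1) (n : ℤ) : Guichardet kinkRef :=
  ((q ^ (-(n * (n + 1) / 2)) : ℝ) : ℂ) • ∑' k : ℕ, kinkTerm hq n k

/-! ### Local observables -/

/-- The algebra `𝒜_Λ` of observables on the finite set `Λ` of sites: linear operators on
`(ℂ²)^{⊗Λ}`, written as matrices in the basis of spin configurations on `Λ`. -/
abbrev LocalObs (Λ : Finset ℤ) : Type := Matrix (Λ → Spin) (Λ → Spin) ℂ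

/-- The configuration that agrees with `t` on `Λ` and with `σ` off `Λ`. -/
def Cfg.replace {Ω : ℤ → Spin} (σ : Cfg Ω) (Λ : Finset ℤ) (t : Λ → Spin) : Cfg Ω :=
  ⟨fun x => if h : x ∈ Λ then t ⟨x, h⟩ else σ.1 x, by
    refine (Λ.finite_toSet.union σ.2).subset fun x hx => ?_
    by_cases h : x ∈ Λ
    · exact Or.inl h
    · right
      simpa [h] using hx⟩

theorem memlp_replace {Ω : ℤ → Spin} (Λ : Finset ℤ) (t : Λ → Spin) (ψ : Guichardet Ω) :
    Summable fun σ : Cfg Ω => ‖ψ.1 (σ.replace Λ t)‖ ^ 2 := by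
  have h1 : Summable fun p : (Λ → Spin) × Cfg Ω => ‖ψ.1 p.2‖ ^ 2 := by
    have h2 : Summable fun _ : Λ → Spin => (1 : ℝ) := Summable.of_finite
    have h3 := h2.mul_of_nonneg (memlp_two_iff.1 ψ.2)
      (fun _ => zero_le_one) (fun _ => sq_nonneg _)
    refine h3.congr fun p => ?_
    rw [one_mul]
  have hi : Function.Injective
      fun σ : Cfg Ω => ((fun x : Λ => σ.1 x), σ.replace Λ t) := by
    intro σ τ h
    apply Subtype.ext
    funext x
    by_cases hx : x ∈ Λ
    · exact congrFun (congrArg Prod.fst h) ⟨x, hx⟩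
    · have := congrFun (congrArg (fun p => p.2.1) h) x
      simpa [Cfg.replace, hx] using this
  have h4 := h1.comp_injective hi
  exact h4

/-- The action of `X ∈ 𝒜_Λ`, that is of `X ⊗ 1` with the identity on `ℤ \ Λ`, on a Guichardet
space over `ℤ`. -/
def LocalObs.act {Λ : Finset ℤ} (X : LocalObs Λ) {Ω : ℤ → Spin} :
    Guichardet Ω →ₗ[ℂ] Guichardet Ω where
  toFun ψ :=
    ⟨fun σ => ∑ t : Λ → Spin, X (fun x => σ.1 x) t * ψ.1 (σ.replace Λ t), by
      have key : ∀ t : Λ → Spin,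
          Memℓp (fun σ : Cfg Ω => X (fun x => σ.1 x) t * ψ.1 (σ.replace Λ t)) 2 := by
        intro t
        refine memlp_two_iff.2 (((memlp_replace Λ t ψ).mul_left
          ((∑ s : Λ → Spin, ‖X s t‖) ^ 2)).of_nonneg_of_le (fun σ => by positivity) fun σ => ?_)
        rw [norm_mul, mul_pow]
        gcongr
        exact Finset.single_le_sum (f := fun s => ‖X s t‖) (fun s _ => norm_nonneg _)
          (Finset.mem_univ (fun x : Λ => σ.1 x))
      exact Memℓp.finsetSum Finset.univ fun t _ => key t⟩
  map_add' φ ψ := by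
    apply Subtype.ext
    funext σ
    change (∑ t : Λ → Spin, X (fun x => σ.1 x) t *
      (φ.1 (σ.replace Λ t) + ψ.1 (σ.replace Λ t))) = _ + _
    simp only [mul_add, Finset.sum_add_distrib]
  map_smul' c ψ := by
    apply Subtype.ext
    funext σ
    change (∑ t : Λ → Spin, X (fun x => σ.1 x) t * (c * ψ.1 (σ.replace Λ t))) =
      c * ∑ t : Λ → Spin, X (fun x => σ.1 x) t * ψ.1 (σ.replace Λ t)
    simp only [Finset.mul_sum, mul_left_comm]

/-- The translation `Ad τᵐ : 𝒜_Λ → 𝒜_{Λ+m}`. -/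
def LocalObs.translate {Λ : Finset ℤ} (m : ℤ) (X : LocalObs Λ) :
    LocalObs (Λ.map (addRightEmbedding m)) :=
  fun s t => X (fun x => s ⟨x + m, Finset.mem_map_of_mem (addRightEmbedding m) x.2⟩)
    (fun x => t ⟨x + m, Finset.mem_map_of_mem (addRightEmbedding m) x.2⟩)

/-- The normalized expectation `⟨ψ, X ψ⟩ / ⟨ψ, ψ⟩` of a local observable. -/
def expectation {Λ : Finset ℤ} (X : LocalObs Λ) {Ω : ℤ → Spin} (ψ : Guichardet Ω) : ℂ :=
  inner ℂ ψ (X.act ψ) / inner ℂ ψ ψ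

/-- The shifted factorial `(a;r)_∞ = ∏_{j ≥ 0} (1 - a r^j)`. -/
def qFactorialInf (a r : ℝ) : ℝ := ∏' j : ℕ, (1 - a * r ^ j)

end XXZ

end

noncomputable section

namespace XXZ

section

/-! ### Coefficients of the states -/

/-! In the product basis both states have explicit coefficients. Write E for the sum of |x| over
flipped sites. The droplet state has coefficient q^E on configurations with n down-spins, and the
kink state of charge k has q^(E - k(k+1)/2) on configurations of charge k (`antikinkKink_apply`,
`kink_apply`). Every expectation is therefore a weighted sum over configurations.

Cut a droplet configuration between the sites -1 and 0. After translation by -m, the part on [0,∞),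
continued by down-spins, is a kink configuration τ that is all down left of -m. The rest is a finite
set B of positive distances from the cut. This is a bijection (`glue_bijective`). Once Λ lies in
[-m,∞), the translated observable sees only τ. If τ has charge c, then |B| = N := n - m - 1 - c.
Summing over B gives q^(N(N+1)) / ∏_{j=1}^{N} (1 - q^(2j)) when N ≥ 0, and 0 otherwise
(`normSetSum_natCast`). Collecting exponents leaves a factor independent of τ times q^(c² + s c)
with s = 4m + 1 - 2n (`inner_antikinkKink`), so s = 1 for n = 2m and s = -1 for n = 2m + 1.

As m → ∞ the truncation disappears and the finite products tend to (q²;q²)_∞. The inverse products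
increase with N, so dominated convergence applies (`tendsto_tsum_truncated`). Grouping the limit by
charge restores the kink expectations. Undoing their normalization adds k(k+1) to the exponent,
giving 2k(k+1) and 2k² (`hasSum_weighted_inner_kink`). The denominator is the case X = 1, together
with the kink norm (`inner_kink_self`). -/

theorem Cfg.mem_flipped {S : Type} {Ω : S → Spin} (σ : Cfg Ω) (x : S) :
    x ∈ σ.flipped ↔ σ.1 x ≠ Ω x := by
  simp [Cfg.flipped]

theorem Cfg.sum_flipped_restrict {Ω : ℤ → Spin} (σ : Cfg Ω) (S : Set ℤ) [DecidablePred (· ∈ S)]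
    (Ω' : S → Spin) (h : ∀ x : S, Ω x = Ω' x) {M : Type} [AddCommMonoid M] (f : ℤ → M) :
    ∑ x ∈ (σ.restrict S Ω' h).flipped, f x = ∑ x ∈ σ.flipped with x ∈ S, f x := by
  refine Finset.sum_bij (fun x _ => (x : ℤ)) (fun x hx => ?_) (fun x _ y _ hxy => Subtype.ext hxy)
    (fun y hy => ?_) (fun _ _ => rfl)
  · rw [Cfg.mem_flipped] at hx
    rw [Finset.mem_filter, Cfg.mem_flipped, h x]
    exact ⟨hx, x.2⟩
  · rw [Finset.mem_filter, Cfg.mem_flipped] at hy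
    refine ⟨⟨y, hy.2⟩, ?_, rfl⟩
    rw [Cfg.mem_flipped, ← h]
    exact hy.1

theorem Cfg.card_flipped_restrict {Ω : ℤ → Spin} (σ : Cfg Ω) (S : Set ℤ) [DecidablePred (· ∈ S)]
    (Ω' : S → Spin) (h : ∀ x : S, Ω x = Ω' x) :
    (σ.restrict S Ω' h).flipped.card = (σ.flipped.filter (· ∈ S)).card := by
  simp only [Finset.card_eq_sum_ones]
  exact σ.sum_flipped_restrict S Ω' h (fun _ => 1)

theorem Cfg.sum_flipped_split {Ω : ℤ → Spin} (σ : Cfg Ω) {M : Type} [AddCommMonoid M]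
    (f : ℤ → M) :
    ∑ x ∈ σ.flipped, f x =
      (∑ x ∈ σ.flipped with x ∈ Set.Iic (0 : ℤ), f x) +
        ∑ x ∈ σ.flipped with x ∈ Set.Ici (1 : ℤ), f x := by
  rw [← Finset.sum_filter_add_sum_filter_not σ.flipped (· ∈ Set.Iic (0 : ℤ))]
  congr 2
  ext x
  simp only [Finset.mem_filter, Set.mem_Iic, Set.mem_Ici, and_congr_right_iff]
  intro _
  constructor <;> intro h <;> omega

/-- The sum of the distances to the origin of the flipped sites. -/
def Cfg.energy {Ω : ℤ → Spin} (σ : Cfg Ω) : ℤ := ∑ x ∈ σ.flipped, |x|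

/-- The number of flipped sites in `[1,∞)` minus the number of flipped sites in `(-∞,0]`. -/
def Cfg.charge {Ω : ℤ → Spin} (σ : Cfg Ω) : ℤ := ∑ x ∈ σ.flipped, if 0 < x then 1 else -1

/-- The cardinality term is the factor q^(-k) in the definitions of the states: it lowers each left
weight 1 - x to -x = |x|, so both half-lines are weighted by the distance to 0. -/
theorem Cfg.energy_eq {Ω : ℤ → Spin} (σ : Cfg Ω) {Ω₁ : Set.Iic (0 : ℤ) → Spin}
    {Ω₂ : Set.Ici (1 : ℤ) → Spin}
    (h₁ : ∀ x : Set.Iic (0 : ℤ), Ω x = Ω₁ x) (h₂ : ∀ x : Set.Ici (1 : ℤ), Ω x = Ω₂ x) :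
    σ.energy = -((σ.restrict _ Ω₁ h₁).flipped.card : ℤ) +
      ∑ x ∈ (σ.restrict _ Ω₁ h₁).flipped, (0 + 1 - (x : ℤ)) +
      ∑ x ∈ (σ.restrict _ Ω₂ h₂).flipped, ((x : ℤ) - 1 + 1) := by
  rw [σ.sum_flipped_restrict _ Ω₁ h₁ (fun x => 0 + 1 - x),
    σ.sum_flipped_restrict _ Ω₂ h₂ (fun x => x - 1 + 1), σ.card_flipped_restrict, Cfg.energy,
    σ.sum_flipped_split, Finset.card_eq_sum_ones]
  push_cast
  rw [← Finset.sum_neg_distrib, ← Finset.sum_add_distrib]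
  congr 1
  · refine Finset.sum_congr rfl fun x hx => ?_
    have : x ≤ 0 := (Finset.mem_filter.1 hx).2
    rw [abs_of_nonpos this]
    ring
  · refine Finset.sum_congr rfl fun x hx => ?_
    have : 1 ≤ x := (Finset.mem_filter.1 hx).2
    rw [abs_of_nonneg (by omega)]
    ring

theorem Cfg.charge_eq {Ω : ℤ → Spin} (σ : Cfg Ω) {Ω₁ : Set.Iic (0 : ℤ) → Spin}
    {Ω₂ : Set.Ici (1 : ℤ) → Spin}
    (h₁ : ∀ x : Set.Iic (0 : ℤ), Ω x = Ω₁ x) (h₂ : ∀ x : Set.Ici (1 : ℤ), Ω x = Ω₂ x) :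
    σ.charge = ((σ.restrict _ Ω₂ h₂).flipped.card : ℤ) -
      ((σ.restrict _ Ω₁ h₁).flipped.card : ℤ) := by
  rw [σ.card_flipped_restrict, σ.card_flipped_restrict, Cfg.charge, σ.sum_flipped_split,
    Finset.card_eq_sum_ones, Finset.card_eq_sum_ones]
  push_cast
  rw [sub_eq_neg_add, ← Finset.sum_neg_distrib]
  congr 1
  · refine Finset.sum_congr rfl fun x hx => ?_
    have : x ≤ 0 := (Finset.mem_filter.1 hx).2
    rw [if_neg (by omega)]
  · refine Finset.sum_congr rfl fun x hx => ?_
    have : 1 ≤ x := (Finset.mem_filter.1 hx).2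
    rw [if_pos (by omega)]

theorem Cfg.card_eq {Ω : ℤ → Spin} (σ : Cfg Ω) {Ω₁ : Set.Iic (0 : ℤ) → Spin}
    {Ω₂ : Set.Ici (1 : ℤ) → Spin}
    (h₁ : ∀ x : Set.Iic (0 : ℤ), Ω x = Ω₁ x) (h₂ : ∀ x : Set.Ici (1 : ℤ), Ω x = Ω₂ x) :
    σ.flipped.card = (σ.restrict _ Ω₁ h₁).flipped.card + (σ.restrict _ Ω₂ h₂).flipped.card := by
  rw [σ.card_flipped_restrict, σ.card_flipped_restrict, Finset.card_eq_sum_ones,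
    σ.sum_flipped_split, Finset.card_eq_sum_ones, Finset.card_eq_sum_ones]

variable {q : ℝ} (hq : q ∈ Set.Ioo (0 : ℝ) 1)

theorem antikinkKink_apply (n : ℕ) (σ : Cfg allUp) :
    (antikinkKink hq n).1 σ = if σ.flipped.card = n then ((q ^ σ.energy : ℝ) : ℂ) else 0 := by
  set σ₁ := σ.restrict _ (fun _ : Set.Iic (0 : ℤ) => Spin.up) (fun _ => rfl) with h₁
  set σ₂ := σ.restrict _ (fun _ : Set.Ici (1 : ℤ) => Spin.up) (fun _ => rfl) with h₂
  have hE : σ.energy = -(σ₁.flipped.card : ℤ) + ∑ x ∈ σ₁.flipped, (0 + 1 - (x : ℤ)) +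
      ∑ x ∈ σ₂.flipped, ((x : ℤ) - 1 + 1) := σ.energy_eq _ _
  have hN : σ.flipped.card = σ₁.flipped.card + σ₂.flipped.card := σ.card_eq _ _
  have hsum : (antikinkKink hq n).1 σ = ∑ k ∈ Finset.range (n + 1), ((q ^ (-(k : ℤ)) : ℝ) : ℂ) *
      ((if (σ₁.flipped.card : ℤ) = k then
          ((q ^ (∑ x ∈ σ₁.flipped, (0 + 1 - (x : ℤ))) : ℝ) : ℂ) else 0) *
        (if (σ₂.flipped.card : ℤ) = (n : ℤ) - k then
          ((q ^ (∑ x ∈ σ₂.flipped, ((x : ℤ) - 1 + 1)) : ℝ) : ℂ) else 0)) := by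
    change (lp.evalCLM ℂ (fun _ : Cfg allUp => ℂ) 2 σ) (antikinkKink hq n) = _
    rw [antikinkKink, map_sum]
    rfl
  rw [hsum]
  split_ifs with h
  -- Only the summand whose k is the number of down-spins on (-∞,0] is nonzero at σ.
  · rw [Finset.sum_eq_single σ₁.flipped.card]
    · rw [if_pos rfl, if_pos (by omega), ← Complex.ofReal_mul, ← Complex.ofReal_mul, hE,
        zpow_add₀ hq.1.ne', zpow_add₀ hq.1.ne', mul_assoc]
    · intro k _ hk
      rw [if_neg (by omega)]
      simp
    · intro hk
      simp only [Finset.mem_range] at hk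
      omega
  · refine Finset.sum_eq_zero fun k _ => ?_
    by_cases h3 : (σ₁.flipped.card : ℤ) = k
    · rw [if_neg (c := (σ₂.flipped.card : ℤ) = (n : ℤ) - k) (by omega)]
      simp
    · rw [if_neg h3]
      simp

theorem kink_apply (n : ℤ) (σ : Cfg kinkRef) :
    (kink hq n).1 σ =
      if σ.charge = n then ((q ^ (-(n * (n + 1) / 2) + σ.energy) : ℝ) : ℂ) else 0 := by
  set σ₁ := σ.restrict _ (fun _ : Set.Iic (0 : ℤ) => Spin.down) kinkRef_left with h₁
  set σ₂ := σ.restrict _ (fun _ : Set.Ici (1 : ℤ) => Spin.up) kinkRef_right with h₂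
  have hE : σ.energy = -(σ₁.flipped.card : ℤ) + ∑ x ∈ σ₁.flipped, (0 + 1 - (x : ℤ)) +
      ∑ x ∈ σ₂.flipped, ((x : ℤ) - 1 + 1) := σ.energy_eq _ _
  have hC : σ.charge = (σ₂.flipped.card : ℤ) - σ₁.flipped.card := σ.charge_eq _ _
  have hsum : (kink hq n).1 σ = ((q ^ (-(n * (n + 1) / 2)) : ℝ) : ℂ) *
      ∑' k : ℕ, ((q ^ (-(k : ℤ)) : ℝ) : ℂ) *
      ((if (σ₁.flipped.card : ℤ) = k then
          ((q ^ (∑ x ∈ σ₁.flipped, (0 + 1 - (x : ℤ))) : ℝ) : ℂ) else 0) *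
        (if (σ₂.flipped.card : ℤ) = n + k then
          ((q ^ (∑ x ∈ σ₂.flipped, ((x : ℤ) - 1 + 1)) : ℝ) : ℂ) else 0)) := by
    -- Evaluation at a basis vector is continuous, so it passes through the norm-convergent series.
    change (lp.evalCLM ℂ (fun _ : Cfg kinkRef => ℂ) 2 σ) (kink hq n) = _
    rw [kink, map_smul, ContinuousLinearMap.map_tsum _ (summable_kinkTerm hq n)]
    rfl
  rw [hsum, tsum_eq_single σ₁.flipped.card]
  · rw [if_pos rfl]
    by_cases h : σ.charge = n
    · rw [if_pos h, if_pos (by omega), ← Complex.ofReal_mul, ← Complex.ofReal_mul,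
        ← Complex.ofReal_mul, hE, zpow_add₀ hq.1.ne', zpow_add₀ hq.1.ne', zpow_add₀ hq.1.ne',
        mul_assoc]
    · rw [if_neg h, if_neg (by omega)]
      simp
  · intro k hk
    rw [if_neg (by omega)]
    simp

/-- The contribution of the basis vector `σ` to the expectation of a local observable. -/
def localTerm (q : ℝ) {Λ : Finset ℤ} (X : LocalObs Λ) (σ : Cfg kinkRef) : ℂ :=
  ∑ t : Λ → Spin, X (fun x => σ.1 x) t *
    if (σ.replace Λ t).charge = σ.charge then
      ((q ^ (σ.energy + (σ.replace Λ t).energy) : ℝ) : ℂ) else 0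

theorem inner_act {Λ : Finset ℤ} (X : LocalObs Λ) {Ω : ℤ → Spin} (ψ : Guichardet Ω) :
    HasSum (fun σ : Cfg Ω => (∑ t : Λ → Spin, X (fun x => σ.1 x) t * ψ.1 (σ.replace Λ t)) *
      (starRingEnd ℂ) (ψ.1 σ)) (inner ℂ ψ (X.act ψ)) :=
  lp.hasSum_inner ψ (X.act ψ)

theorem even_mul_succ (k : ℤ) : k * (k + 1) / 2 + k * (k + 1) / 2 = k * (k + 1) := by
  obtain ⟨c, hc⟩ := Int.even_mul_succ_self k
  omega

/-- The normalization of the kink state enters twice, and twice k(k+1)/2 is exactly k(k+1) because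
k(k+1) is even. -/
theorem hasSum_inner_kink {Λ : Finset ℤ} (X : LocalObs Λ) (k : ℤ) :
    HasSum (fun σ : Cfg kinkRef => if σ.charge = k then
      ((q ^ (-(k * (k + 1))) : ℝ) : ℂ) * localTerm q X σ else 0)
      (inner ℂ (kink hq k) (X.act (kink hq k))) := by
  refine (inner_act X (kink hq k)).congr_fun fun σ => ?_
  simp only [kink_apply]
  split_ifs with h
  · rw [localTerm, Finset.mul_sum, Finset.sum_mul, h]
    refine Finset.sum_congr rfl fun t _ => ?_
    split_ifs with h2
    · rw [Complex.conj_ofReal, mul_assoc, mul_left_comm, ← Complex.ofReal_mul,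
        ← Complex.ofReal_mul, ← zpow_add₀ hq.1.ne', ← zpow_add₀ hq.1.ne']
      congr 3
      have := even_mul_succ k
      omega
    · simp
  · simp

end

section

/-! ### Generating functions of finite sets of natural numbers -/

variable {q : ℝ} (hq : q ∈ Set.Ioo (0 : ℝ) 1)

/-- The generating function `∑_{|B| = N} q^{2 ∑_{b ∈ B} (b + 1)}` of the sets of `N` positive
integers. -/
def setSum (q : ℝ) (N : ℤ) : ℝ :=
  ∑' B : Finset ℕ, if (B.card : ℤ) = N then q ^ (2 * ∑ b ∈ B, ((b : ℤ) + 1)) else 0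

include hq in
theorem zpow_two_mul_sum {ι : Type} (s : Finset ι) (f : ι → ℤ) :
    q ^ (2 * ∑ x ∈ s, f x) = ∏ x ∈ s, (q ^ f x) ^ 2 := by
  classical
  induction s using Finset.induction_on with
  | empty => simp
  | insert a s ha ih =>
    rw [Finset.sum_insert ha, Finset.prod_insert ha, mul_add, zpow_add₀ hq.1.ne', ih]
    congr 1
    rw [← zpow_natCast, ← zpow_mul, mul_comm]
    rfl

include hq in
theorem summable_setWeight :
    Summable fun B : Finset ℕ => q ^ (2 * ∑ b ∈ B, ((b : ℤ) + 1)) := by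
  have h : Summable fun b : ℕ => (q ^ ((b : ℤ) + 1)) ^ 2 := by
    refine (((summable_geometric_of_lt_one (by positivity)
      (pow_lt_one₀ hq.1.le hq.2 two_ne_zero)).mul_left (q ^ 2))).congr fun b => ?_
    rw [zpow_add₀ hq.1.ne', zpow_natCast, zpow_one]
    ring
  exact (summable_finsetProd_of_summable_nonneg (fun _ => sq_nonneg _) h).congr
    fun B => (zpow_two_mul_sum hq B _).symm

include hq in
theorem summable_setSum (N : ℤ) : Summable fun B : Finset ℕ =>
    if (B.card : ℤ) = N then q ^ (2 * ∑ b ∈ B, ((b : ℤ) + 1)) else 0 := by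
  have := hq.1
  refine (summable_setWeight hq).of_nonneg_of_le (fun B => ?_) (fun B => ?_)
  · split_ifs <;> positivity
  · split_ifs
    · exact le_rfl
    · positivity

theorem setSum_of_neg {N : ℤ} (hN : N < 0) : setSum q N = 0 := by
  refine (tsum_congr fun B => if_neg ?_).trans tsum_zero
  have : (0 : ℤ) ≤ B.card := Int.natCast_nonneg _
  omega

theorem setSum_zero : setSum q 0 = 1 := by
  rw [setSum, tsum_eq_single ∅]
  · simp
  · intro B hB
    rw [if_neg]
    simpa using hB

/-- Shifting a set of natural numbers by one. -/
def shiftSet (B : Finset ℕ) : Finset ℕ := B.map (addRightEmbedding 1)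

/-- A set of natural numbers is the shift of a set, possibly with `0` added. -/
def finsetNatEquiv : Finset ℕ ⊕ Finset ℕ ≃ Finset ℕ where
  toFun := Sum.elim shiftSet fun B => insert 0 (shiftSet B)
  invFun C := if 0 ∈ C then Sum.inr ((C.erase 0).image (· - 1)) else Sum.inl (C.image (· - 1))
  left_inv := by
    rintro (B | B)
    · have : (0 : ℕ) ∉ shiftSet B := by simp [shiftSet]
      change (if (0 : ℕ) ∈ shiftSet B then _ else _) = _
      rw [if_neg this]
      congr 1
      ext x
      simp [shiftSet]
    · have : (0 : ℕ) ∉ shiftSet B := by simp [shiftSet]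
      change (if (0 : ℕ) ∈ insert 0 (shiftSet B) then _ else _) = _
      rw [if_pos (Finset.mem_insert_self _ _), Sum.elim_inr, Finset.erase_insert this]
      congr 1
      ext x
      simp [shiftSet]
  right_inv C := by
    by_cases h : 0 ∈ C
    · simp only [if_pos h, Sum.elim_inr]
      ext x
      rcases x with _ | x
      · simpa using h
      · simp only [shiftSet, Finset.mem_insert, Finset.mem_map, Finset.mem_image, Finset.mem_erase,
          addRightEmbedding_apply]
        constructor
        · rintro (h0 | ⟨a, ⟨b, ⟨hb, hb'⟩, rfl⟩, h2⟩)
          · omega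
          · have : b = x + 1 := by omega
            exact this ▸ hb'
        · exact fun hx => Or.inr ⟨x, ⟨x + 1, ⟨by omega, hx⟩, rfl⟩, rfl⟩
    · simp only [if_neg h, Sum.elim_inl]
      ext x
      simp only [shiftSet, Finset.mem_map, Finset.mem_image, addRightEmbedding_apply]
      constructor
      · rintro ⟨a, ⟨b, hb, rfl⟩, h2⟩
        have h0 : b ≠ 0 := fun h0 => h (h0 ▸ hb)
        have : b = x := by omega
        exact this ▸ hb
      · intro hx
        have h0 : x ≠ 0 := fun h0 => h (h0 ▸ hx)
        exact ⟨x - 1, ⟨x, hx, rfl⟩, by omega⟩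

theorem sum_shiftSet (B : Finset ℕ) :
    ∑ b ∈ shiftSet B, ((b : ℤ) + 1) = B.card + ∑ b ∈ B, ((b : ℤ) + 1) := by
  rw [shiftSet, Finset.sum_map, Finset.card_eq_sum_ones]
  push_cast
  rw [← Finset.sum_add_distrib]
  refine Finset.sum_congr rfl fun b _ => ?_
  simp
  ring

include hq in
-- A set either omits 0 and is the shift of an N-set, or contains 0 and is otherwise the shift of an
-- (N-1)-set. In both cases the total weight increases by N.
theorem setSum_rec (N : ℤ) :
    setSum q N = q ^ (2 * N) * setSum q N + q ^ (2 * N) * setSum q (N - 1) := by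
  have hs := (summable_setSum hq N)
  have hs' : Summable _ := (finsetNatEquiv.summable_iff.2 hs)
  conv_lhs => rw [setSum, ← finsetNatEquiv.tsum_eq]
  refine (Summable.tsum_sum (hs'.comp_injective Sum.inl_injective)
    (hs'.comp_injective Sum.inr_injective)).trans ?_
  rw [setSum, setSum, ← tsum_mul_left, ← tsum_mul_left]
  congr 1
  · refine tsum_congr fun B => ?_
    change (if ((shiftSet B).card : ℤ) = N then q ^ (2 * ∑ b ∈ shiftSet B, ((b : ℤ) + 1))
      else 0) = _
    rw [sum_shiftSet, show (shiftSet B).card = B.card from Finset.card_map _]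
    split_ifs with h
    · rw [← zpow_add₀ hq.1.ne', h, mul_add]
    · simp
  · refine tsum_congr fun B => ?_
    change (if ((insert 0 (shiftSet B)).card : ℤ) = N then
      q ^ (2 * ∑ b ∈ insert 0 (shiftSet B), ((b : ℤ) + 1)) else 0) = _
    have h0 : (0 : ℕ) ∉ shiftSet B := by simp [shiftSet]
    rw [Finset.card_insert_of_notMem h0, Finset.sum_insert h0, sum_shiftSet,
      show (shiftSet B).card = B.card from Finset.card_map _]
    by_cases h : (B.card : ℤ) = N - 1
    · rw [if_pos h, if_pos (by push_cast; omega), ← zpow_add₀ hq.1.ne', h]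
      congr 1
      push_cast
      ring
    · rw [if_neg h, if_neg (by push_cast; omega)]
      simp

/-- The generating function `setSum`, normalized by its leading term. -/
def normSetSum (q : ℝ) (N : ℤ) : ℝ := q ^ (-(N * (N + 1))) * setSum q N

theorem normSetSum_of_neg {N : ℤ} (hN : N < 0) : normSetSum q N = 0 := by
  rw [normSetSum, setSum_of_neg hN, mul_zero]

include hq in
-- The recurrence, solved for `setSum q (N + 1)`, gains one factor of the product at each step; the
-- leading powers telescope to q^(N(N+1)).
theorem normSetSum_natCast (N : ℕ) :
    normSetSum q N = (∏ j ∈ Finset.range N, (1 - q ^ 2 * (q ^ 2) ^ j))⁻¹ := by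
  induction N with
  | zero => simp [normSetSum, setSum_zero]
  | succ N ih =>
    have hlt : q ^ 2 * (q ^ 2) ^ N < 1 := by
      rw [← pow_succ', ← pow_mul]
      exact pow_lt_one₀ hq.1.le hq.2 (by omega)
    have hr := setSum_rec hq (N + 1 : ℕ)
    have he : q ^ (2 * ((N + 1 : ℕ) : ℤ)) = q ^ 2 * (q ^ 2) ^ N := by
      rw [← pow_succ', ← pow_mul, ← zpow_natCast]
      push_cast
      rfl
    rw [Finset.prod_range_succ, mul_inv, ← ih, eq_mul_inv_iff_mul_eq₀ (by linarith), normSetSum,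
      normSetSum]
    have h1 : setSum q (N + 1 : ℕ) * (1 - q ^ 2 * (q ^ 2) ^ N) =
        q ^ (2 * ((N + 1 : ℕ) : ℤ)) * setSum q N := by
      have h2 : (((N + 1 : ℕ) : ℤ)) - 1 = N := by push_cast; ring
      rw [h2] at hr
      rw [← he]
      linarith
    rw [mul_assoc, h1, ← mul_assoc, ← zpow_add₀ hq.1.ne']
    congr 2
    push_cast
    ring

include hq in
theorem qFactorialInf_pos : 0 < qFactorialInf (q ^ 2) (q ^ 2) := by
  have h1 : ∀ j : ℕ, 0 < 1 - q ^ 2 * (q ^ 2) ^ j := fun j => by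
    rw [← pow_succ', ← pow_mul, sub_pos]
    exact pow_lt_one₀ hq.1.le hq.2 (by omega)
  have h2 : Summable fun j : ℕ => -(q ^ 2 * (q ^ 2) ^ j) :=
    ((summable_geometric_of_lt_one (by positivity)
      (pow_lt_one₀ hq.1.le hq.2 two_ne_zero)).mul_left (q ^ 2)).neg
  have h3 := Real.summable_log_one_add_of_summable h2
  rw [qFactorialInf, ← Real.rexp_tsum_eq_tprod h1 (by simpa [sub_eq_add_neg] using h3)]
  exact Real.exp_pos _

include hq in
theorem tendsto_normSetSum_nat : Tendsto (fun N : ℕ => normSetSum q N) atTop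
    (𝓝 (qFactorialInf (q ^ 2) (q ^ 2))⁻¹) := by
  have h2 : Summable fun j : ℕ => -(q ^ 2 * (q ^ 2) ^ j) :=
    ((summable_geometric_of_lt_one (by positivity)
      (pow_lt_one₀ hq.1.le hq.2 two_ne_zero)).mul_left (q ^ 2)).neg
  have h3 := (Real.multipliable_one_add_of_summable h2).hasProd.tendsto_prod_nat
  simp only [← sub_eq_add_neg] at h3
  simp only [normSetSum_natCast hq]
  exact h3.inv₀ (qFactorialInf_pos hq).ne'

include hq in
theorem tendsto_normSetSum {l : Filter ℕ} {u : ℕ → ℤ} (hu : Tendsto u l atTop) :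
    Tendsto (fun m => normSetSum q (u m)) l (𝓝 (qFactorialInf (q ^ 2) (q ^ 2))⁻¹) := by
  have h : Tendsto (normSetSum q) atTop (𝓝 (qFactorialInf (q ^ 2) (q ^ 2))⁻¹) := by
    rw [← Nat.map_cast_int_atTop]
    exact tendsto_map'_iff.2 (tendsto_normSetSum_nat hq)
  exact h.comp hu

include hq in
theorem normSetSum_nonneg (N : ℤ) : 0 ≤ normSetSum q N := by
  have := hq.1
  refine mul_nonneg (by positivity) (tsum_nonneg fun B => ?_)
  split_ifs <;> positivity

include hq in
-- Every factor of the product lies in (0,1), so its inverse increases to the limit. This uniform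
-- bound is the constant used in dominated convergence.
theorem normSetSum_le (N : ℤ) : normSetSum q N ≤ (qFactorialInf (q ^ 2) (q ^ 2))⁻¹ := by
  rcases lt_or_ge N 0 with hN | hN
  · rw [normSetSum_of_neg hN]
    exact (inv_pos.2 (qFactorialInf_pos hq)).le
  · lift N to ℕ using hN
    refine Monotone.ge_of_tendsto (f := fun N : ℕ => normSetSum q N)
      (monotone_nat_of_le_succ fun n => ?_) (tendsto_normSetSum_nat hq) N
    have h1 : ∀ j : ℕ, 0 < 1 - q ^ 2 * (q ^ 2) ^ j := fun j => by
      rw [← pow_succ', ← pow_mul, sub_pos]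
      exact pow_lt_one₀ hq.1.le hq.2 (by omega)
    have h2 : 0 ≤ q ^ 2 * (q ^ 2) ^ n := by positivity
    rw [normSetSum_natCast hq, normSetSum_natCast hq, Finset.prod_range_succ]
    refine inv_anti₀ (mul_pos (Finset.prod_pos fun j _ => h1 j) (h1 n)) ?_
    exact mul_le_of_le_one_right (Finset.prod_pos fun j _ => h1 j).le (by linarith)

end

section

/-! ### Absolute convergence of the sum over the kink configurations -/

theorem Cfg.flipped_inj {S : Type} (Ω : S → Spin) :
    Function.Injective (Cfg.flipped : Cfg Ω → Finset S) := by
  intro σ τ h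
  apply Subtype.ext
  funext x
  have hx : σ.1 x ≠ Ω x ↔ τ.1 x ≠ Ω x := by
    rw [← Cfg.mem_flipped, ← Cfg.mem_flipped, h]
  cases h0 : Ω x <;> cases h1 : σ.1 x <;> cases h2 : τ.1 x <;> simp_all

variable {q : ℝ} (hq : q ∈ Set.Ioo (0 : ℝ) 1)

include hq in
theorem summable_zpow_abs : Summable fun x : ℤ => (q ^ |x|) ^ 2 := by
  have h : Summable fun n : ℕ => (q ^ 2) ^ n :=
    summable_geometric_of_lt_one (by positivity) (pow_lt_one₀ hq.1.le hq.2 two_ne_zero)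
  refine Summable.of_nat_of_neg (h.congr fun n => ?_) (h.congr fun n => ?_) <;>
  · simp only [abs_neg, Nat.abs_cast, zpow_natCast]
    ring

include hq in
theorem summable_energy (Ω : ℤ → Spin) : Summable fun σ : Cfg Ω => (q ^ σ.energy) ^ 2 := by
  refine ((summable_finsetProd_of_summable_nonneg (fun _ => sq_nonneg _)
    (summable_zpow_abs hq)).comp_injective (Cfg.flipped_inj Ω)).congr fun σ => ?_
  rw [Function.comp, ← zpow_two_mul_sum hq, ← zpow_natCast, ← zpow_mul, mul_comm]
  rfl

include hq in
theorem summable_energy_replace {Ω : ℤ → Spin} (Λ : Finset ℤ) (t : Λ → Spin) :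
    Summable fun σ : Cfg Ω => (q ^ (σ.replace Λ t).energy) ^ 2 := by
  have h : ∀ σ : Cfg Ω, ‖((q ^ σ.energy : ℝ) : ℂ)‖ ^ 2 = (q ^ σ.energy) ^ 2 := fun σ => by
    rw [Complex.norm_real, Real.norm_eq_abs, sq_abs]
  -- The weights q^E form an ℓ² vector, and replacing the spins on Λ preserves square-summability
  -- because it is finite-to-one.
  refine (memlp_replace Λ t (Ω := Ω) ⟨fun σ => ((q ^ σ.energy : ℝ) : ℂ),
    memlp_two_iff.2 ((summable_energy hq Ω).congr fun σ => (h σ).symm)⟩).congr fun σ => ?_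
  exact h (σ.replace Λ t)

include hq in
-- The cross weight q^(E + E') is bounded by q^(2E) + q^(2E'), and both are summable over all
-- configurations, with no restriction on the charge.
theorem summable_norm_localTerm {Λ : Finset ℤ} (X : LocalObs Λ) :
    Summable fun σ : Cfg kinkRef => ‖localTerm q X σ‖ := by
  have hq0 := hq.1
  have hs : Summable fun σ : Cfg kinkRef => ∑ t : Λ → Spin, (∑ s : Λ → Spin, ‖X s t‖) *
      ((q ^ σ.energy) ^ 2 + (q ^ (σ.replace Λ t).energy) ^ 2) :=
    summable_sum fun t _ =>
      ((summable_energy hq kinkRef).add (summable_energy_replace hq Λ t)).mul_left _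
  refine hs.of_nonneg_of_le (fun _ => norm_nonneg _) fun σ => ?_
  refine (norm_sum_le _ _).trans (Finset.sum_le_sum fun t _ => ?_)
  rw [norm_mul]
  refine mul_le_mul ?_ ?_ (norm_nonneg _) (Finset.sum_nonneg fun _ _ => norm_nonneg _)
  · exact Finset.single_le_sum (f := fun s => ‖X s t‖) (fun s _ => norm_nonneg _)
      (Finset.mem_univ (fun x : Λ => σ.1 x))
  · split_ifs
    · rw [Complex.norm_real, Real.norm_of_nonneg (by positivity), zpow_add₀ hq.1.ne']
      nlinarith [sq_nonneg (q ^ σ.energy - q ^ (σ.replace Λ t).energy),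
        sq_nonneg (q ^ σ.energy), sq_nonneg (q ^ (σ.replace Λ t).energy)]
    · rw [norm_zero]
      positivity

/-- The contribution of `σ` to the weighted sum over all charges of kink expectations. -/
def weightedTerm (q : ℝ) (s : ℤ) {Λ : Finset ℤ} (X : LocalObs Λ) (σ : Cfg kinkRef) : ℂ :=
  ((q ^ (σ.charge ^ 2 + s * σ.charge) : ℝ) : ℂ) * localTerm q X σ

include hq in
theorem summable_norm_weightedTerm {s : ℤ} (hs : ∀ k : ℤ, 0 ≤ k ^ 2 + s * k) {Λ : Finset ℤ}
    (X : LocalObs Λ) : Summable fun σ => ‖weightedTerm q s X σ‖ := by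
  have hq0 := hq.1
  refine (summable_norm_localTerm hq X).of_nonneg_of_le (fun _ => norm_nonneg _) fun σ => ?_
  rw [weightedTerm, norm_mul, Complex.norm_real, Real.norm_of_nonneg (by positivity)]
  refine mul_le_of_le_one_left (norm_nonneg _) ?_
  obtain ⟨j, hj⟩ := Int.eq_ofNat_of_zero_le (hs σ.charge)
  rw [hj, zpow_natCast]
  exact pow_le_one₀ hq.1.le hq.2.le

/-- The absolutely convergent sum over configurations is regrouped along the fibres of the charge;
the extra k(k+1) cancels the normalization of the kink states. -/
theorem hasSum_weighted_inner_kink {s : ℤ} (hs : ∀ k : ℤ, 0 ≤ k ^ 2 + s * k) {Λ : Finset ℤ}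
    (X : LocalObs Λ) :
    HasSum (fun k : ℤ => ((q ^ (k ^ 2 + s * k + k * (k + 1)) : ℝ) : ℂ) *
      inner ℂ (kink hq k) (X.act (kink hq k))) (∑' σ, weightedTerm q s X σ) := by
  refine ((summable_norm_weightedTerm hq hs X).of_norm.hasSum.tsum_fiberwise
    Cfg.charge).congr_fun fun k => ?_
  rw [← (hasSum_inner_kink hq X k).tsum_eq, ← tsum_mul_left,
    tsum_subtype (Cfg.charge ⁻¹' {k}) (weightedTerm q s X)]
  refine tsum_congr fun σ => ?_
  by_cases h : σ.charge = k
  · rw [Set.indicator_of_mem (by simpa using h), if_pos h, weightedTerm, ← mul_assoc,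
      ← Complex.ofReal_mul, ← zpow_add₀ hq.1.ne', h]
    congr 3
    ring
  · rw [Set.indicator_of_notMem (by simpa using h), if_neg h, mul_zero]

/-! ### The identity observable -/

theorem Cfg.replace_self {Ω : ℤ → Spin} (σ : Cfg Ω) (Λ : Finset ℤ) :
    σ.replace Λ (fun x => σ.1 x) = σ := by
  apply Subtype.ext
  funext x
  simp [Cfg.replace]

theorem LocalObs.act_one {Λ : Finset ℤ} {Ω : ℤ → Spin} (ψ : Guichardet Ω) :
    (1 : LocalObs Λ).act ψ = ψ := by
  apply Subtype.ext
  funext σ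
  change ∑ t : Λ → Spin, (1 : LocalObs Λ) (fun x => σ.1 x) t * ψ.1 (σ.replace Λ t) = _
  simp only [Matrix.one_apply, ite_mul, one_mul, zero_mul, Finset.sum_ite_eq, Finset.mem_univ,
    if_true]
  exact congrArg (fun τ : Cfg Ω => (ψ.1 τ : ℂ)) (σ.replace_self Λ)

theorem LocalObs.translate_one {Λ : Finset ℤ} (m : ℤ) : (1 : LocalObs Λ).translate m = 1 := by
  ext s t
  rw [LocalObs.translate, Matrix.one_apply, Matrix.one_apply]
  refine if_congr ⟨fun h => ?_, fun h => by rw [h]⟩ rfl rfl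
  funext ⟨y, hy⟩
  obtain ⟨x, hx, rfl⟩ := Finset.mem_map.1 hy
  exact congrFun h ⟨x, hx⟩

theorem localTerm_one {Λ : Finset ℤ} (σ : Cfg kinkRef) :
    localTerm q (1 : LocalObs Λ) σ = ((q ^ (2 * σ.energy) : ℝ) : ℂ) := by
  rw [localTerm]
  simp only [Matrix.one_apply]
  rw [Finset.sum_eq_single (fun x : Λ => σ.1 x)]
  · rw [if_pos rfl, Cfg.replace_self, if_pos rfl, one_mul, two_mul]
  · intro t _ ht
    rw [if_neg ht.symm, zero_mul]
  · exact fun h => absurd (Finset.mem_univ _) h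

end

section

/-! ### Truncated configurations -/

/-- The configurations with down-spins at all sites to the left of `-m`. -/
def truncated (m : ℕ) : Set (Cfg kinkRef) := {τ | ∀ x : ℤ, x < -m → τ.1 x = Spin.down}

theorem eventually_mem_truncated (τ : Cfg kinkRef) : ∀ᶠ m : ℕ in atTop, τ ∈ truncated m := by
  obtain ⟨a, ha⟩ := τ.2.bddBelow
  filter_upwards [eventually_ge_atTop a.natAbs] with m hm x hx
  by_contra h
  have h0 : kinkRef x = Spin.down := kinkRef_left ⟨x, by simp only [Set.mem_Iic]; omega⟩
  have := ha (show τ.1 x ≠ kinkRef x by rwa [h0])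
  omega

/-- The sites of `[-m,∞)` with down-spins. -/
def Cfg.downs (τ : Cfg kinkRef) (m : ℕ) : Finset ℤ :=
  {x ∈ Finset.Icc (-(m : ℤ)) 0 ∪ τ.flipped | -(m : ℤ) ≤ x ∧ τ.1 x = Spin.down}

theorem Cfg.mem_downs (τ : Cfg kinkRef) (m : ℕ) (x : ℤ) :
    x ∈ τ.downs m ↔ -(m : ℤ) ≤ x ∧ τ.1 x = Spin.down := by
  rw [Cfg.downs, Finset.mem_filter, and_iff_right_iff_imp]
  rintro ⟨h1, h2⟩
  rw [Finset.mem_union, Finset.mem_Icc, Cfg.mem_flipped, h2, kinkRef]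
  by_cases h : 0 < x
  · simp [h]
  · exact Or.inl ⟨h1, by omega⟩

/-- Relative to the filled background [-m,0], a flip at a positive site adds a down-spin and a flip
at a nonpositive site removes one. Truncation ensures that no flip lies left of -m. -/
theorem Cfg.sum_downs {m : ℕ} {τ : Cfg kinkRef} (hτ : τ ∈ truncated m) (f : ℤ → ℤ) :
    ∑ x ∈ τ.downs m, f x = ∑ x ∈ Finset.Icc (-(m : ℤ)) 0, f x +
      ∑ x ∈ τ.flipped, (if 0 < x then 1 else -1) * f x := by
  set U := Finset.Icc (-(m : ℤ)) 0 ∪ τ.flipped with hU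
  have h1 : Finset.Icc (-(m : ℤ)) 0 = U.filter (· ∈ Finset.Icc (-(m : ℤ)) 0) := by
    ext x; simp [hU]; omega
  have h2 : τ.flipped = U.filter (· ∈ τ.flipped) := by
    ext x
    rw [Finset.mem_filter, hU, Finset.mem_union]
    tauto
  conv_rhs => rw [h1, h2]
  rw [Cfg.downs, ← hU, Finset.sum_filter, Finset.sum_filter, Finset.sum_filter,
    ← Finset.sum_add_distrib]
  refine Finset.sum_congr rfl fun x _ => ?_
  simp only [Cfg.mem_flipped, Finset.mem_Icc]
  by_cases hx : -(m : ℤ) ≤ x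
  · by_cases h0 : 0 < x
    · have : kinkRef x = Spin.up := by simp [kinkRef, h0]
      rw [this]
      cases h : τ.1 x <;> simp [hx, h0]
    · have : kinkRef x = Spin.down := by simp [kinkRef, h0]
      rw [this]
      have h0' : x ≤ 0 := by omega
      cases h : τ.1 x <;> simp [hx, h0, h0']
  · have h0 : ¬ 0 < x := by omega
    have : kinkRef x = Spin.down := by simp [kinkRef, h0]
    rw [this, hτ x (by omega)]
    simp [hx]

theorem Cfg.card_downs {m : ℕ} {τ : Cfg kinkRef} (hτ : τ ∈ truncated m) :
    ((τ.downs m).card : ℤ) = m + 1 + τ.charge := by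
  have := Cfg.sum_downs hτ (fun _ => 1)
  simp only [mul_one] at this
  rw [Finset.card_eq_sum_ones]
  push_cast
  rw [this, Cfg.charge]
  congr 1
  simp
  omega

theorem two_mul_sum_Icc (m : ℕ) :
    2 * ∑ x ∈ Finset.Icc (-(m : ℤ)) 0, (x + m) = m * (m + 1) := by
  have h : ∑ x ∈ Finset.Icc (-(m : ℤ)) 0, (x + m) = ∑ i ∈ Finset.range (m + 1), (i : ℤ) := by
    refine Finset.sum_nbij' (fun x : ℤ => (x + m).toNat) (fun i => (i : ℤ) - m) ?_ ?_ ?_ ?_ ?_ <;>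
      simp <;> intros <;> omega
  have h2 := Finset.sum_range_id_mul_two (m + 1)
  rw [h, mul_comm]
  have h3 : ((∑ i ∈ Finset.range (m + 1), i : ℕ) : ℤ) * 2 = (m + 1) * m := by exact_mod_cast h2
  rw [mul_comm (m : ℤ), ← h3]
  push_cast
  rfl

theorem Cfg.two_mul_sum_downs {m : ℕ} {τ : Cfg kinkRef} (hτ : τ ∈ truncated m) :
    2 * ∑ x ∈ τ.downs m, (x + m) = 2 * τ.energy + 2 * m * τ.charge + m * (m + 1) := by
  rw [Cfg.sum_downs hτ, mul_add, two_mul_sum_Icc, Cfg.energy, Cfg.charge, Finset.mul_sum,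
    Finset.mul_sum, Finset.mul_sum, ← Finset.sum_add_distrib, add_comm]
  congr 1
  refine Finset.sum_congr rfl fun x _ => ?_
  split_ifs with h
  · rw [abs_of_pos h]; ring
  · rw [abs_of_nonpos (by omega)]; ring

/-- The truncated configuration whose down-spins in `[-m,∞)` are at the sites `y - m` for
`y ∈ Y`. -/
def truncatedCfg (m : ℕ) (Y : Finset ℕ) : Cfg kinkRef :=
  ⟨fun x => if x < -m ∨ (x + m).toNat ∈ Y then Spin.down else Spin.up, by
    refine ((Set.finite_Icc (-(m : ℤ)) 0).union
      (Y.finite_toSet.image (fun y : ℕ => (y : ℤ) - m))).subset fun x hx => ?_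
    change (if x < -m ∨ (x + m).toNat ∈ Y then Spin.down else Spin.up) ≠ kinkRef x at hx
    by_cases h : -(m : ℤ) ≤ x ∧ x ≤ 0
    · exact Or.inl h
    · refine Or.inr ⟨(x + m).toNat, ?_, ?_⟩
      · by_contra hY
        rw [Finset.mem_coe] at hY
        simp only [hY, or_false, kinkRef] at hx
        split_ifs at hx <;> first | omega | exact hx rfl
      · by_contra hY
        have h1 : x < -m := by
          simp only at hY
          omega
        rw [if_pos (Or.inl h1), kinkRef, if_neg (by omega)] at hx
        exact hx rfl⟩

theorem truncatedCfg_eq_down (m : ℕ) (Y : Finset ℕ) (x : ℤ) :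
    (truncatedCfg m Y).1 x = Spin.down ↔ x < -m ∨ (x + m).toNat ∈ Y := by
  change (if x < -m ∨ (x + m).toNat ∈ Y then Spin.down else Spin.up) = Spin.down ↔ _
  split_ifs with h
  · exact iff_of_true rfl h
  · exact iff_of_false id h

theorem Spin.eq_iff {a b : Spin} : a = b ↔ (a = Spin.down ↔ b = Spin.down) := by
  cases a <;> cases b <;> simp

/-- A truncated configuration is determined by its down-spins in `[-m,∞)`. -/
def truncatedEquiv (m : ℕ) : Finset ℕ ≃ truncated m where
  toFun Y := ⟨truncatedCfg m Y, fun x hx => (truncatedCfg_eq_down m Y x).2 (Or.inl hx)⟩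
  invFun τ := (τ.1.downs m).image fun x : ℤ => (x + m).toNat
  left_inv Y := by
    ext y
    simp only [Finset.mem_image, Cfg.mem_downs, truncatedCfg_eq_down]
    constructor
    · rintro ⟨x, ⟨h1, h2⟩, rfl⟩
      exact h2.resolve_left (by omega)
    · intro hy
      exact ⟨(y : ℤ) - m, ⟨by omega, Or.inr (by simpa using hy)⟩, by omega⟩
  right_inv τ := by
    apply Subtype.ext
    apply Subtype.ext
    funext x
    rw [Spin.eq_iff, truncatedCfg_eq_down, Finset.mem_image]
    constructor
    · rintro (hx | ⟨y, hy, hxy⟩)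
      · exact τ.2 x hx
      · rw [Cfg.mem_downs] at hy
        by_cases hx : x < -(m : ℤ)
        · exact τ.2 x hx
        · have : y = x := by omega
          exact this ▸ hy.2
    · intro hd
      by_cases hx : x < -(m : ℤ)
      · exact Or.inl hx
      · exact Or.inr ⟨x, (Cfg.mem_downs _ _ _).2 ⟨by omega, hd⟩, rfl⟩

theorem sum_truncatedEquiv_symm {m : ℕ} (τ : truncated m) {M : Type} [AddCommMonoid M]
    (f : ℤ → M) : ∑ y ∈ (truncatedEquiv m).symm τ, f y = ∑ x ∈ τ.1.downs m, f (x + m) := by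
  change ∑ y ∈ (τ.1.downs m).image (fun x : ℤ => (x + m).toNat), f y = _
  rw [Finset.sum_image]
  · refine Finset.sum_congr rfl fun x hx => ?_
    rw [Cfg.mem_downs] at hx
    rw [Int.toNat_of_nonneg (by omega)]
  · intro x hx y hy hxy
    rw [Finset.mem_coe, Cfg.mem_downs] at hx hy
    simp only at hxy
    omega

theorem card_truncatedEquiv_symm {m : ℕ} (τ : truncated m) :
    (((truncatedEquiv m).symm τ).card : ℤ) = m + 1 + τ.1.charge := by
  rw [← Cfg.card_downs τ.2, Finset.card_eq_sum_ones, Finset.card_eq_sum_ones,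
    sum_truncatedEquiv_symm τ (fun _ => 1)]

theorem two_mul_sum_truncatedEquiv_symm {m : ℕ} (τ : truncated m) :
    2 * ∑ y ∈ (truncatedEquiv m).symm τ, ((y : ℤ) + 1) =
      2 * τ.1.energy + 2 * m * τ.1.charge + m * (m + 1) + 2 * (m + 1 + τ.1.charge) := by
  rw [sum_truncatedEquiv_symm τ (fun y => y + 1), Finset.sum_add_distrib, mul_add,
    Cfg.two_mul_sum_downs τ.2, ← Cfg.card_downs τ.2]
  simp

variable {q : ℝ} (hq : q ∈ Set.Ioo (0 : ℝ) 1)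

include hq in
-- Recording the down-spins in [-m,∞) by their distance to -m identifies truncated configurations of
-- charge k with sets of m + 1 + k natural numbers; the normalizing powers match exactly.
theorem tsum_truncated_charge (m : ℕ) (k : ℤ) :
    ∑' τ : Cfg kinkRef, (truncated m).indicator (fun τ => if τ.charge = k then
      q ^ (-(k * (k + 1)) + 2 * τ.energy) else 0) τ = normSetSum q (m + 1 + k) := by
  rw [← tsum_subtype, ← (truncatedEquiv m).tsum_eq, normSetSum, setSum, ← tsum_mul_left]
  refine tsum_congr fun Y => ?_
  obtain ⟨τ, rfl⟩ := (truncatedEquiv m).symm.surjective Y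
  rw [Equiv.apply_symm_apply, card_truncatedEquiv_symm, two_mul_sum_truncatedEquiv_symm]
  by_cases h : τ.1.charge = k
  · rw [if_pos h, if_pos (by omega), ← zpow_add₀ hq.1.ne', h]
    congr 1
    ring
  · rw [if_neg h, if_neg (by omega), mul_zero]

/-- The squared norm of the kink states. -/
theorem inner_kink_self (k : ℤ) : inner ℂ (kink hq k) (kink hq k) =
    (((qFactorialInf (q ^ 2) (q ^ 2))⁻¹ : ℝ) : ℂ) := by
  have hq0 := hq.1
  -- The norm is the expectation of the identity, for which the empty support suffices.
  have h1 := hasSum_inner_kink hq (1 : LocalObs ∅) k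
  rw [LocalObs.act_one] at h1
  have h2 : (fun σ : Cfg kinkRef => if σ.charge = k then
      ((q ^ (-(k * (k + 1))) : ℝ) : ℂ) * localTerm q (1 : LocalObs ∅) σ else 0) =
      fun σ => ((if σ.charge = k then q ^ (-(k * (k + 1)) + 2 * σ.energy) else 0 : ℝ) : ℂ) := by
    funext σ
    rw [localTerm_one]
    split_ifs
    · rw [← Complex.ofReal_mul, ← zpow_add₀ hq.1.ne']
    · simp
  rw [h2] at h1
  have hs : Summable fun σ : Cfg kinkRef =>
      if σ.charge = k then q ^ (-(k * (k + 1)) + 2 * σ.energy) else 0 :=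
    Complex.summable_ofReal.1 h1.summable
  rw [← h1.tsum_eq, ← Complex.ofReal_tsum]
  congr 1
  have hnn : ∀ σ : Cfg kinkRef,
      0 ≤ if σ.charge = k then q ^ (-(k * (k + 1)) + 2 * σ.energy) else 0 := fun σ => by
    split_ifs <;> positivity
  -- Each configuration is eventually truncated, so the full sum is the limit of the truncated sums,
  -- which are already known in closed form.
  have ht := tendsto_tsum_of_dominated_convergence (𝓕 := (atTop : Filter ℕ))
    (f := fun m => (truncated m).indicator (fun τ : Cfg kinkRef => if τ.charge = k then
      q ^ (-(k * (k + 1)) + 2 * τ.energy) else 0)) hs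
    (fun τ => tendsto_const_nhds.congr' <| (eventually_mem_truncated τ).mono fun m hm =>
      (Set.indicator_of_mem hm _).symm)
    (Eventually.of_forall fun m τ => (norm_indicator_le_norm_self _ _).trans
      (Real.norm_of_nonneg (hnn τ)).le)
  simp only [tsum_truncated_charge hq] at ht
  refine tendsto_nhds_unique ht (tendsto_normSetSum hq ?_)
  exact tendsto_atTop_add_const_right _ _
    (tendsto_atTop_add_const_right _ _ tendsto_natCast_atTop_atTop)

end

section

/-! ### Gluing a kink configuration to a set of down-spins on the far left -/

/-- The configuration of finitely many down-spins on `ℤ` which is the translate of `τ` by `m` on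
`[0,∞)` and has down-spins at the sites `-b - 1`, `b ∈ B`, on `(-∞,-1]`. -/
def glue (m : ℕ) (τ : Cfg kinkRef) (B : Finset ℕ) : Cfg allUp :=
  ⟨fun x => if 0 ≤ x then τ.1 (x - m) else if (-x - 1).toNat ∈ B then Spin.down else Spin.up, by
    refine ((τ.downs m).finite_toSet.image (fun y => y + (m : ℤ))).union
      (B.finite_toSet.image (fun b : ℕ => -(b : ℤ) - 1)) |>.subset fun x hx => ?_
    change (if 0 ≤ x then τ.1 (x - m) else if (-x - 1).toNat ∈ B then Spin.down else Spin.up) ≠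
      Spin.up at hx
    by_cases h : 0 ≤ x
    · rw [if_pos h] at hx
      refine Or.inl ⟨x - m, (Cfg.mem_downs _ _ _).2 ⟨by omega, ?_⟩, by simp⟩
      cases h1 : τ.1 (x - m)
      · exact absurd h1 hx
      · rfl
    · rw [if_neg h] at hx
      refine Or.inr ⟨(-x - 1).toNat, ?_, by simp only; omega⟩
      by_contra hB
      exact hx (if_neg hB)⟩

theorem glue_of_nonneg (m : ℕ) (τ : Cfg kinkRef) (B : Finset ℕ) {x : ℤ} (hx : 0 ≤ x) :
    (glue m τ B).1 x = τ.1 (x - m) := if_pos hx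

theorem glue_of_neg (m : ℕ) (τ : Cfg kinkRef) (B : Finset ℕ) {x : ℤ} (hx : x < 0) :
    (glue m τ B).1 x = Spin.down ↔ (-x - 1).toNat ∈ B := by
  simp [glue, not_le.2 hx]

theorem sum_flipped_glue (m : ℕ) (τ : Cfg kinkRef) (B : Finset ℕ) {M : Type} [AddCommMonoid M]
    (f : ℤ → M) : ∑ x ∈ (glue m τ B).flipped, f x =
      ∑ y ∈ τ.downs m, f (y + m) + ∑ b ∈ B, f (-(b : ℤ) - 1) := by
  have hflip : ∀ x, x ∈ (glue m τ B).flipped ↔ (glue m τ B).1 x = Spin.down := fun x => by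
    rw [Cfg.mem_flipped, allUp]
    cases (glue m τ B).1 x <;> simp
  rw [← Finset.sum_filter_add_sum_filter_not (glue m τ B).flipped (0 ≤ ·)]
  congr 1
  · symm
    refine Finset.sum_bij (fun y _ => y + m) ?_ (fun _ _ _ _ h => add_right_cancel h) ?_
      (fun _ _ => rfl)
    · intro y hy
      rw [Cfg.mem_downs] at hy
      rw [Finset.mem_filter, hflip, glue_of_nonneg _ _ _ (by omega), add_sub_cancel_right]
      exact ⟨hy.2, by omega⟩
    · intro x hx
      rw [Finset.mem_filter, hflip] at hx
      rw [glue_of_nonneg _ _ _ hx.2] at hx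
      exact ⟨x - m, (Cfg.mem_downs _ _ _).2 ⟨by omega, hx.1⟩, by simp⟩
  · symm
    refine Finset.sum_bij (fun (b : ℕ) _ => -(b : ℤ) - 1) ?_ (fun _ _ _ _ h => by omega) ?_
      (fun _ _ => rfl)
    · intro b hb
      rw [Finset.mem_filter, hflip, glue_of_neg _ _ _ (by omega)]
      have : (-(-(b : ℤ) - 1) - 1).toNat = b := by omega
      rw [this]
      exact ⟨hb, by omega⟩
    · intro x hx
      rw [Finset.mem_filter, hflip] at hx
      rw [glue_of_neg _ _ _ (by omega)] at hx
      exact ⟨_, hx.1, by omega⟩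

theorem card_flipped_glue {m : ℕ} {τ : Cfg kinkRef} (hτ : τ ∈ truncated m) (B : Finset ℕ) :
    ((glue m τ B).flipped.card : ℤ) = m + 1 + τ.charge + B.card := by
  rw [← Cfg.card_downs hτ, Finset.card_eq_sum_ones, sum_flipped_glue, Finset.card_eq_sum_ones,
    Finset.card_eq_sum_ones]
  push_cast
  rfl

/-- Doubling avoids halving m(m+1). The term 2m times the charge arises because the distances of τ
are now measured from -m. -/
theorem two_mul_energy_glue {m : ℕ} {τ : Cfg kinkRef} (hτ : τ ∈ truncated m) (B : Finset ℕ) :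
    2 * (glue m τ B).energy = 2 * τ.energy + 2 * m * τ.charge + m * (m + 1) +
      2 * ∑ b ∈ B, ((b : ℤ) + 1) := by
  rw [← Cfg.two_mul_sum_downs hτ, Cfg.energy, sum_flipped_glue, mul_add]
  congr 2
  · refine Finset.sum_congr rfl fun y hy => ?_
    rw [Cfg.mem_downs] at hy
    exact abs_of_nonneg (by omega)
  · refine Finset.sum_congr rfl fun b _ => ?_
    rw [abs_of_nonpos (by omega)]
    ring

theorem glue_bijective (m : ℕ) :
    Function.Bijective fun p : truncated m × Finset ℕ => glue m p.1 p.2 := by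
  constructor
  · rintro ⟨τ, B⟩ ⟨τ', B'⟩ h
    simp only at h
    refine Prod.ext (Subtype.ext (Subtype.ext (funext fun x => ?_))) (Finset.ext fun b => ?_)
    · by_cases hx : x < -(m : ℤ)
      · exact (τ.2 x hx).trans (τ'.2 x hx).symm
      · have h1 := glue_of_nonneg m τ B (x := x + m) (by omega)
        have h2 := glue_of_nonneg m τ' B' (x := x + m) (by omega)
        rw [add_sub_cancel_right] at h1 h2
        rw [← h1, ← h2, h]
    · have h1 := glue_of_neg m τ B (x := -(b : ℤ) - 1) (by omega)
      have h2 := glue_of_neg m τ' B' (x := -(b : ℤ) - 1) (by omega)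
      have hb : (-(-(b : ℤ) - 1) - 1).toNat = b := by omega
      rw [hb] at h1 h2
      exact h1.symm.trans ((by rw [h] : _ ↔ _).trans h2)
  · intro σ
    have hd : ∀ x, σ.1 x = Spin.down ↔ x ∈ σ.flipped := fun x => by
      rw [Cfg.mem_flipped, allUp]
      cases σ.1 x <;> simp
    let τ : Cfg kinkRef := ⟨fun x => if x < -m then Spin.down else σ.1 (x + m), by
      refine ((Set.finite_Icc (-(m : ℤ)) 0).union
        (σ.flipped.finite_toSet.image (fun x : ℤ => x - m))).subset fun x hx => ?_
      change (if x < -m then Spin.down else σ.1 (x + m)) ≠ kinkRef x at hx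
      by_cases h1 : x < -(m : ℤ)
      · rw [if_pos h1, kinkRef, if_neg (by omega)] at hx
        exact absurd rfl hx
      · rw [if_neg h1] at hx
        by_cases h2 : 0 < x
        · refine Or.inr ⟨x + m, ?_, by simp⟩
          rw [kinkRef, if_pos h2] at hx
          exact (Cfg.mem_flipped _ _).2 hx
        · exact Or.inl ⟨by omega, by omega⟩⟩
    have hτ : τ ∈ truncated m := fun x hx => if_pos hx
    refine ⟨⟨⟨τ, hτ⟩, {x ∈ σ.flipped | x < 0}.image fun x : ℤ => (-x - 1).toNat⟩, ?_⟩
    apply Subtype.ext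
    funext x
    by_cases hx : 0 ≤ x
    · refine (glue_of_nonneg m τ _ hx).trans ?_
      refine (if_neg (by omega)).trans ?_
      rw [sub_add_cancel]
    · rw [Spin.eq_iff]
      refine (glue_of_neg m τ _ (not_le.1 hx)).trans ?_
      rw [hd, Finset.mem_image]
      constructor
      · rintro ⟨y, hy, hxy⟩
        rw [Finset.mem_filter] at hy
        have : y = x := by omega
        exact this ▸ hy.1
      · exact fun h => ⟨x, Finset.mem_filter.2 ⟨h, not_le.1 hx⟩, rfl⟩

theorem replace_mem_truncated {m : ℕ} {τ : Cfg kinkRef} (hτ : τ ∈ truncated m) {Λ : Finset ℤ}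
    (hΛ : ∀ x ∈ Λ, -(m : ℤ) ≤ x) (t : Λ → Spin) : τ.replace Λ t ∈ truncated m := by
  intro x hx
  refine (dif_neg fun h => ?_).trans (hτ x hx)
  have := hΛ x h
  omega

/-- The bound on Λ puts its translate inside [0,∞), so a local change acts on τ and leaves B
untouched. -/
theorem glue_replace {m : ℕ} (τ : Cfg kinkRef) (B : Finset ℕ) {Λ : Finset ℤ}
    (hΛ : ∀ x ∈ Λ, -(m : ℤ) ≤ x) (t : Λ.map (addRightEmbedding (m : ℤ)) → Spin) :
    (glue m τ B).replace _ t = glue m (τ.replace Λ fun x =>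
      t ⟨x + m, Finset.mem_map_of_mem (addRightEmbedding (m : ℤ)) x.2⟩) B := by
  apply Subtype.ext
  funext x
  have hmem : x ∈ Λ.map (addRightEmbedding (m : ℤ)) ↔ x - m ∈ Λ := by
    simp only [Finset.mem_map, addRightEmbedding_apply]
    exact ⟨by rintro ⟨a, ha, rfl⟩; simpa using ha, fun h => ⟨x - m, h, by simp⟩⟩
  by_cases hx : x - m ∈ Λ
  · have h0 : 0 ≤ x := by have := hΛ _ hx; omega
    rw [glue_of_nonneg _ _ _ h0]
    refine (dif_pos (hmem.2 hx)).trans ?_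
    refine Eq.trans ?_ (dif_pos hx).symm
    congr 2
    simp
  · refine (dif_neg (mt hmem.1 hx)).trans ?_
    by_cases h0 : 0 ≤ x
    · rw [glue_of_nonneg _ _ _ h0, glue_of_nonneg _ _ _ h0]
      symm
      exact dif_neg hx
    · rw [Spin.eq_iff, glue_of_neg _ _ _ (not_le.1 h0), glue_of_neg _ _ _ (not_le.1 h0)]

/-- Spin configurations on `Λ` and on its translate. -/
def translateEquiv (Λ : Finset ℤ) (m : ℤ) :
    (Λ.map (addRightEmbedding m) → Spin) ≃ (Λ → Spin) where
  toFun t x := t ⟨x + m, Finset.mem_map_of_mem (addRightEmbedding m) x.2⟩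
  invFun t y := t ⟨y - m, by
    obtain ⟨x, hx, h⟩ := Finset.mem_map.1 y.2
    rwa [← h, addRightEmbedding_apply, add_sub_cancel_right]⟩
  left_inv t := by
    funext y
    simp
  right_inv t := by
    funext x
    simp

variable {q : ℝ} (hq : q ∈ Set.Ioo (0 : ℝ) 1)

/-- With B fixed, conserving the number of down-spins is the same as conserving the charge of τ. The
summand therefore factors into a local kink term and a weight of B, which are coupled only through
the charge. -/
theorem sum_translate_glue {m : ℕ} {τ : Cfg kinkRef} (hτ : τ ∈ truncated m) (B : Finset ℕ)
    {Λ : Finset ℤ} (hΛ : ∀ x ∈ Λ, -(m : ℤ) ≤ x) (X : LocalObs Λ) (n : ℕ) :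
    (∑ t : Λ.map (addRightEmbedding (m : ℤ)) → Spin,
        X.translate (m : ℤ) (fun x => (glue m τ B).1 x) t *
          (antikinkKink hq n).1 ((glue m τ B).replace _ t)) *
      (starRingEnd ℂ) ((antikinkKink hq n).1 (glue m τ B)) =
    ((q ^ (2 * m * τ.charge + m * (m + 1)) : ℝ) : ℂ) * localTerm q X τ *
      (((if (B.card : ℤ) = n - m - 1 - τ.charge then q ^ (2 * ∑ b ∈ B, ((b : ℤ) + 1)) else 0 :
        ℝ)) : ℂ) := by
  have hre : (∑ t : Λ.map (addRightEmbedding (m : ℤ)) → Spin,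
        X.translate (m : ℤ) (fun x => (glue m τ B).1 x) t *
          (antikinkKink hq n).1 ((glue m τ B).replace _ t)) =
      ∑ t : Λ → Spin, X (fun x => τ.1 x) t *
        (antikinkKink hq n).1 (glue m (τ.replace Λ t) B) := by
    refine Fintype.sum_equiv (translateEquiv Λ m) _ _ fun t => ?_
    rw [glue_replace τ B hΛ]
    have h1 : ∀ x : Λ, (glue m τ B).1 ((x : ℤ) + m) = τ.1 x := fun x => by
      have := hΛ x x.2
      rw [glue_of_nonneg _ _ _ (by omega), add_sub_cancel_right]
    simp only [LocalObs.translate, h1]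
    rfl
  rw [hre]
  simp only [antikinkKink_apply]
  have hc := card_flipped_glue hτ B
  by_cases h : (B.card : ℤ) = n - m - 1 - τ.charge
  · rw [if_pos h, if_pos (by omega), localTerm, Finset.sum_mul, Finset.mul_sum, Finset.sum_mul]
    refine Finset.sum_congr rfl fun t _ => ?_
    have hc' := card_flipped_glue (replace_mem_truncated hτ hΛ t) B
    by_cases ht : (τ.replace Λ t).charge = τ.charge
    · have e1 := two_mul_energy_glue hτ B
      have e2 := two_mul_energy_glue (replace_mem_truncated hτ hΛ t) B
      rw [ht] at e2
      have e : q ^ (glue m (τ.replace Λ t) B).energy * q ^ (glue m τ B).energy =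
          q ^ (2 * m * τ.charge + m * (m + 1)) * q ^ (τ.energy + (τ.replace Λ t).energy) *
            q ^ (2 * ∑ b ∈ B, ((b : ℤ) + 1)) := by
        rw [← zpow_add₀ hq.1.ne', ← zpow_add₀ hq.1.ne', ← zpow_add₀ hq.1.ne']
        congr 1
        linarith
      have e' := congrArg Complex.ofReal e
      rw [Complex.ofReal_mul, Complex.ofReal_mul, Complex.ofReal_mul] at e'
      rw [if_pos ht, if_pos (by omega), Complex.conj_ofReal, mul_assoc, e']
      ring
    · rw [if_neg ht, if_neg (by omega)]
      simp
  · rw [if_neg h, if_neg (by omega)]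
    simp

theorem inner_antikinkKink {m n : ℕ} {s : ℤ} (hn : 2 * (n : ℤ) = 4 * m + 1 - s) {Λ : Finset ℤ}
    (hΛ : ∀ x ∈ Λ, -(m : ℤ) ≤ x) (X : LocalObs Λ) :
    inner ℂ (antikinkKink hq n) ((X.translate (m : ℤ)).act (antikinkKink hq n)) =
      ((q ^ ((m : ℤ) * (m + 1) + (n - m - 1) * (n - m)) : ℝ) : ℂ) *
        ∑' τ : Cfg kinkRef, (truncated m).indicator (fun τ =>
          ((normSetSum q (n - m - 1 - τ.charge) : ℝ) : ℂ) * weightedTerm q s X τ) τ := by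
  have h := inner_act (X.translate (m : ℤ)) (antikinkKink hq n)
  have h1 := (Equiv.ofBijective _ (glue_bijective m)).hasSum_iff.2 h
  rw [← h1.tsum_eq, h1.summable.tsum_prod, ← tsum_subtype, ← tsum_mul_left]
  refine tsum_congr fun τ => ?_
  refine (tsum_congr fun B => sum_translate_glue hq τ.2 B hΛ X n).trans ?_
  rw [tsum_mul_left, ← Complex.ofReal_tsum]
  change _ * ((setSum q (n - m - 1 - τ.1.charge) : ℝ) : ℂ) = _
  rw [normSetSum, weightedTerm]
  generalize setSum q (n - m - 1 - τ.1.charge) = S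
  -- Expanding N(N+1) for N = n - m - 1 - c and adding 2mc leaves c² + (4m + 1 - 2n)c, which is
  -- where s comes from.
  have hexp : q ^ (2 * m * τ.1.charge + m * (m + 1)) =
      q ^ ((m : ℤ) * (m + 1) + (n - m - 1) * (n - m)) *
        q ^ (-((n - m - 1 - τ.1.charge) * (n - m - 1 - τ.1.charge + 1))) *
        q ^ (τ.1.charge ^ 2 + s * τ.1.charge) := by
    rw [← zpow_add₀ hq.1.ne', ← zpow_add₀ hq.1.ne']
    congr 1
    have : s = 4 * m + 1 - 2 * n := by omega
    rw [this]
    ring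
  rw [hexp]
  push_cast
  ring

include hq in
theorem tendsto_tsum_truncated {s : ℤ} (hs : ∀ k : ℤ, 0 ≤ k ^ 2 + s * k) {n : ℕ → ℕ}
    (hn : ∀ m, 2 * (n m : ℤ) = 4 * m + 1 - s) {Λ : Finset ℤ} (X : LocalObs Λ) :
    Tendsto (fun m : ℕ => ∑' τ : Cfg kinkRef, (truncated m).indicator (fun τ =>
      ((normSetSum q (n m - m - 1 - τ.charge) : ℝ) : ℂ) * weightedTerm q s X τ) τ) atTop
      (𝓝 ((((qFactorialInf (q ^ 2) (q ^ 2))⁻¹ : ℝ) : ℂ) * ∑' τ, weightedTerm q s X τ)) := by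
  rw [← tsum_mul_left]
  refine tendsto_tsum_of_dominated_convergence
    ((summable_norm_weightedTerm hq hs X).mul_left (qFactorialInf (q ^ 2) (q ^ 2))⁻¹)
    (fun τ => ?_) (Eventually.of_forall fun m τ => ?_)
  · have h1 : Tendsto (fun m : ℕ => (n m - m - 1 - τ.charge : ℤ)) atTop atTop := by
      -- Since n = 2m + (1 - s)/2, the number of sites left for B grows like m for each fixed
      -- charge.
      refine tendsto_atTop_mono (f := fun m : ℕ => (m : ℤ) + (-s.natAbs - 1 - τ.charge))
        (fun m => ?_) (tendsto_atTop_add_const_right _ _ tendsto_natCast_atTop_atTop)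
      have := hn m
      omega
    have h2 := (Complex.continuous_ofReal.tendsto _).comp (tendsto_normSetSum hq h1)
    refine (h2.mul_const (weightedTerm q s X τ)).congr' ?_
    filter_upwards [eventually_mem_truncated τ] with m hm
    rw [Set.indicator_of_mem hm]
    rfl
  · refine (norm_indicator_le_norm_self _ _).trans ?_
    rw [norm_mul, Complex.norm_real, Real.norm_of_nonneg (normSetSum_nonneg hq _)]
    exact mul_le_mul_of_nonneg_right (normSetSum_le hq _) (norm_nonneg _)

/-- The limit of the translated expectations in the antikink-kink states, in a form that treats
even and odd numbers of down-spins uniformly. -/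
theorem tendsto_expectation {s : ℤ} (hs : ∀ k : ℤ, 0 ≤ k ^ 2 + s * k) {n : ℕ → ℕ}
    (hn : ∀ m, 2 * (n m : ℤ) = 4 * m + 1 - s) {Λ : Finset ℤ} (X : LocalObs Λ) {w : ℤ → ℤ}
    (hw : ∀ k, k ^ 2 + s * k + k * (k + 1) = w k) :
    Summable (fun k : ℤ => q ^ w k) ∧
      Summable (fun k : ℤ => ((q ^ w k : ℝ) : ℂ) *
        inner ℂ (kink hq k) (X.act (kink hq k))) ∧
      Tendsto (fun m : ℕ => expectation (X.translate (m : ℤ)) (antikinkKink hq (n m))) atTop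
        (𝓝 ((∑' k : ℤ, ((q ^ w k : ℝ) : ℂ) * inner ℂ (kink hq k) (X.act (kink hq k))) /
          ((∑' k : ℤ, q ^ w k / qFactorialInf (q ^ 2) (q ^ 2) : ℝ) : ℂ))) := by
  have hL := qFactorialInf_pos hq
  have hX := hasSum_weighted_inner_kink hq hs X
  have h1 := hasSum_weighted_inner_kink hq hs (1 : LocalObs Λ)
  simp only [hw, LocalObs.act_one, inner_kink_self, ← Complex.ofReal_mul, ← div_eq_mul_inv]
    at hX h1
  have hsum : Summable fun k : ℤ => q ^ w k / qFactorialInf (q ^ 2) (q ^ 2) :=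
    Complex.summable_ofReal.1 h1.summable
  -- A strictly positive denominator is needed to pass to the limit in the quotient.
  have hpos : 0 < ∑' k : ℤ, q ^ w k / qFactorialInf (q ^ 2) (q ^ 2) :=
    hsum.tsum_pos (fun k => (div_pos (zpow_pos hq.1 _) hL).le) 0 (div_pos (zpow_pos hq.1 _) hL)
  refine ⟨?_, hX.summable, ?_⟩
  · refine (hsum.mul_right (qFactorialInf (q ^ 2) (q ^ 2))).congr fun k => ?_
    rw [div_mul_cancel₀ _ hL.ne']
  · have hT := (tendsto_tsum_truncated hq hs hn X).div
      (tendsto_tsum_truncated hq hs hn (1 : LocalObs Λ)) (by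
        rw [← h1.tsum_eq, ← Complex.ofReal_tsum, ← Complex.ofReal_mul]
        exact Complex.ofReal_ne_zero.2 (mul_pos (inv_pos.2 hL) hpos).ne')
    rw [mul_div_mul_left _ _ (Complex.ofReal_ne_zero.2 (inv_pos.2 hL).ne'), ← hX.tsum_eq,
      ← h1.tsum_eq, ← Complex.ofReal_tsum] at hT
    refine hT.congr' ?_
    obtain ⟨a, ha⟩ := Λ.bddBelow
    filter_upwards [eventually_ge_atTop a.natAbs] with m hm
    have hΛ : ∀ x ∈ Λ, -(m : ℤ) ≤ x := fun x hx => by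
      have := ha hx
      omega
    -- The identity on the same Λ produces the same prefactor in the norm, so it cancels from the
    -- quotient.
    have hi := inner_antikinkKink hq (hn m) hΛ (1 : LocalObs Λ)
    rw [LocalObs.translate_one, LocalObs.act_one] at hi
    rw [expectation, inner_antikinkKink hq (hn m) hΛ X, hi, mul_div_mul_left]
    · rfl
    · exact Complex.ofReal_ne_zero.2 (zpow_pos hq.1 _).ne'

end

end XXZ

end

theorem mainTheorem11 (q : ℝ) (hq : q ∈ Set.Ioo (0 : ℝ) 1) (Λ : Finset ℤ)
    (X : XXZ.LocalObs Λ) :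
    (Summable (fun k : ℤ => q ^ (2 * k * (k + 1))) ∧
      Summable (fun k : ℤ => ((q ^ (2 * k * (k + 1)) : ℝ) : ℂ) *
        inner ℂ (XXZ.kink hq k) (X.act (XXZ.kink hq k))) ∧
      Tendsto
        (fun m : ℕ => XXZ.expectation (X.translate (m : ℤ)) (XXZ.antikinkKink hq (2 * m)))
        atTop
        (𝓝 ((∑' k : ℤ, ((q ^ (2 * k * (k + 1)) : ℝ) : ℂ) *
            inner ℂ (XXZ.kink hq k) (X.act (XXZ.kink hq k))) /
          ((∑' k : ℤ, q ^ (2 * k * (k + 1)) / XXZ.qFactorialInf (q ^ 2) (q ^ 2) : ℝ) : ℂ)))) ∧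
    (Summable (fun k : ℤ => q ^ (2 * k ^ 2)) ∧
      Summable (fun k : ℤ => ((q ^ (2 * k ^ 2) : ℝ) : ℂ) *
        inner ℂ (XXZ.kink hq k) (X.act (XXZ.kink hq k))) ∧
      Tendsto
        (fun m : ℕ => XXZ.expectation (X.translate (m : ℤ)) (XXZ.antikinkKink hq (2 * m + 1)))
        atTop
        (𝓝 ((∑' k : ℤ, ((q ^ (2 * k ^ 2) : ℝ) : ℂ) *
            inner ℂ (XXZ.kink hq k) (X.act (XXZ.kink hq k))) /
          ((∑' k : ℤ, q ^ (2 * k ^ 2) / XXZ.qFactorialInf (q ^ 2) (q ^ 2) : ℝ) : ℂ)))) := by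
  refine ⟨?_, ?_⟩
  · exact XXZ.tendsto_expectation hq (s := 1) (n := fun m => 2 * m)
      -- For s = ±1, k² + s k is a product of two consecutive integers, hence nonnegative.
      (fun k => by rcases le_or_gt 0 k with h | h <;> nlinarith) (fun m => by push_cast; ring) X
      (fun k => by ring)
  · exact XXZ.tendsto_expectation hq (s := -1) (n := fun m => 2 * m + 1)
      (fun k => by rcases le_or_gt k 0 with h | h <;> nlinarith) (fun m => by push_cast; ring) X
      (fun k => by ring)
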